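/- **Theorem 1.1 (Local existence).** Let $\Omega=\mathbb{R}^3$ or $\Omega=\mathbb{T}^3$ (a torus of any side length $L>0$), and consider the modified quantum Boltzmann equation $$\partial_tF+v\cdot\nabla_xF=\int_{\mathbb{R}^3}\int_{\mathbb{S}^2}B\,\big[F(u')F(v')(1-\delta F(u))(1-\delta F(v))-F(u)F(v)(1-\delta F(u'))(1-\delta F(v'))\big]\,d\omega\,du,\qquad F(0,x,v)=F_0(x,v),$$ for $t\ge 0$, $x\in\Omega$, $v\in\mathbb{R}^3$, where $0\le\delta\le1$, $v'=v-[(v-u)\cdot\omega]\omega$, $u'=u+[(v-u)\cdot\omega]\omega$, and $B=|v-u|^\gamma b(\theta)$ with $\cos\theta=\frac{(v-u)\cdot\omega}{|v-u|}$ and $b$ measurable, $0\le b(\theta)\le C_b|\cos\theta|$. For $\rho>0$ put $$\mu(v)=\frac{1}{\delta+\rho e^{|v|^2/2}},\qquad \sqrt{\bar\mu}(v)=\sqrt{\mu(v)(1-\delta\mu(v))},\qquad w_\beta(v)=(1+|v|)^\beta,$$ and write $F=\mu+\sqrt{\bar\mu}\,f$, $F_0=\mu+\sqrt{\bar\mu}\,f_0$.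 Let $$\nu_\delta(v)=\int_{\mathbb{R}^3}\int_{\mathbb{S}^2} B\,\big[\mu(u)-\delta\mu(u)\mu(u')-\delta\mu(u)\mu(v')+\delta\mu(u')\mu(v')\big]\,d\omega\,du,$$ $$\begin{aligned}K_\delta f(v)=\int_{\mathbb{R}^3}\int_{\mathbb{S}^2} B\,\Big[&\tfrac{\sqrt{\bar\mu}(u')}{\sqrt{\bar\mu}(v)}\big(\mu(v')-\delta\mu(v')\mu(u)-\delta\mu(v')\mu(v)+\delta\mu(u)\mu(v)\big)f(u')\\&+\tfrac{\sqrt{\bar\mu}(v')}{\sqrt{\bar\mu}(v)}\big(\mu(u')-\delta\mu(u')\mu(u)-\delta\mu(u')\mu(v)+\delta\mu(u)\mu(v)\big)f(v')\\&-\tfrac{\sqrt{\bar\mu}(u)}{\sqrt{\bar\mu}(v)}\big(\mu(v)-\delta\mu(v)\mu(u')-\delta\mu(v)\mu(v')+\delta\mu(u')\mu(v')\big)f(u)\Big]\,d\omega\,du,\end{aligned}$$ and, with $g=\sqrt{\bar\mu}f$, $$\begin{aligned}\Gamma_\delta(f)(v)=\tfrac{1}{\sqrt{\bar\mu}(v)}\int_{\mathbb{R}^3}\int_{\mathbb{S}^2}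 B\,\Big[&g(u')g(v')(1-\delta\mu(v)-\delta\mu(u))-g(u)g(v)(1-\delta\mu(v')-\delta\mu(u'))\\&+\delta g(v')g(u)(\mu(v)-\mu(u'))+\delta g(u')g(u)(\mu(v)-\mu(v'))\\&+\delta g(v')g(v)(\mu(u)-\mu(u'))+\delta g(u')g(v)(\mu(u)-\mu(v'))\\&+\delta g(u)g(v)\big(g(u')+g(v')\big)-\delta g(u')g(v')\big(g(u)+g(v)\big)\Big]\,d\omega\,du .\end{aligned}$$ A *mild solution on* $[0,T]$ is a function $F=\mu+\sqrt{\bar\mu}f$ with $f$ measurable and bounded on $[0,T]\times\Omega\times\mathbb{R}^3$ such that for all $(t,x,v)\in[0,T]\times\Omega\times\mathbb{R}^3$ $$\begin{aligned}f(t,x,v)=e^{-\nu_\delta(v)t}f_0(x-vt,v)&+\int_0^te^{-\nu_\delta(v)(t-s)}(K_\delta f)(s,x-v(t-s),v)\,ds\\&+\int_0^te^{-\nu_\delta(v)(t-s)}\Gamma_\delta(f)(s,x-v(t-s),v)\,ds.\end{aligned}$$ Norms are suprema: $\|g\|_{L^\infty_{v,x}}=\sup_{v}\sup_{x}|g(x,v)|$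 and $\|f\|_{L^\infty_TL^\infty_{v,x}}=\sup_{t\in[0,T]}\|f(t)\|_{L^\infty_{v,x}}$. There is a positive continuous function $\rho\mapsto C_{*\rho}$ on $(0,\infty)$ and, for all $-3<\gamma<0$, $\beta>6$ and $C_b$, a constant $C_1=C_1(\beta,\gamma,C_b)>0$ such that the following holds for every $b$, $\Omega$ as above, every $\rho>0$ and every $\delta\in[0,1]$ (so the constants do not depend on $\delta$, and $C_1$ does not depend on $\rho$). If $f_0$ is measurable, $0\le F_0\le 1/\delta$ (only $F_0\ge0$ if $\delta=0$) and $\|w_\beta f_0\|_{L^\infty_{v,x}}<\infty$, then with $$T_1:=\frac{C_1}{C_{*\rho}\left(1+\|w_\beta f_0\|_{L^\infty_{v,x}}+\|w_\beta f_0\|_{L^\infty_{v,x}}^2\right)}$$ the Cauchy problem has a unique mild solution $F=\mu+\sqrt{\bar\mu}f$ on $[0,T_1]$. This solution satisfies $0\le F\le1/\delta$ (only $F\ge 0$ if $\delta=0$) on $[0,T_1]\times\Omega\times\mathbb{R}^3$ and $$\|w_\beta f\|_{L^\infty_{T_1}L^\infty_{v,x}}\le2\|w_\beta f_0\|_{L^\infty_{v,x}}.$$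 -/

import Mathlib

open MeasureTheory Set
open scoped ENNReal

noncomputable section

namespace QuantumBoltzmann

/-- Velocity space `ℝ³` with its Euclidean structure. -/
abbrev V3 : Type := EuclideanSpace ℝ (Fin 3)

/-- The unit sphere `S²` in `ℝ³`. -/
abbrev S2 : Type := Metric.sphere (0 : V3) 1

/-- The surface measure `dω` on `S²` (of total mass `4π`). -/
def sphereMeasure : Measure S2 := (volume : Measure V3).toSphere

/-- The spatial domain: the whole space `ℝ³`, or a torus `𝕋³` of side length `L > 0`. -/
inductive Domain : Type
  | wholeSpace : Domain
  | torus (L : ℝ) (hL : 0 < L) : Domain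

/-- The points of the spatial domain `Ω`. -/
def Domain.Point : Domain → Type
  | .wholeSpace => V3
  | .torus L _ => Fin 3 → AddCircle L

/-- The Borel σ-algebra of `Ω`. -/
instance Domain.instMeasurableSpacePoint (Ω : Domain) : MeasurableSpace Ω.Point :=
  match Ω with
  | .wholeSpace => inferInstanceAs (MeasurableSpace V3)
  | .torus L _ => inferInstanceAs (MeasurableSpace (Fin 3 → AddCircle L))

/-- `Ω.back x y` is the point `x - y` of `Ω`, for `x ∈ Ω` and a displacement `y ∈ ℝ³`
(on the torus the displacement is read modulo the periods). -/
def Domain.back : (Ω : Domain) → Ω.Point → V3 → Ω.Point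
  | .wholeSpace => fun (x : V3) y => x - y
  | .torus L _ => fun (x : Fin 3 → AddCircle L) y i => x i - ((y i : ℝ) : AddCircle L)

/-- The post-collision velocity `v' = v - [(v - u)·ω] ω`. -/
def postV (v u : V3) (ω : S2) : V3 := v - (inner ℝ (v - u) (ω : V3)) • (ω : V3)

/-- The post-collision velocity `u' = u + [(v - u)·ω] ω`. -/
def postU (v u : V3) (ω : S2) : V3 := u + (inner ℝ (v - u) (ω : V3)) • (ω : V3)

/-- The collision kernel `B(v - u, θ) = |v - u|^γ b(θ)`, where `θ ∈ [0, π]` is the angle between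
`v - u` and `ω`, that is `cos θ = (v - u)·ω / |v - u|`. -/
def kernelB (γ : ℝ) (b : ℝ → ℝ) (v u : V3) (ω : S2) : ℝ :=
  ‖v - u‖ ^ γ * b (InnerProductGeometry.angle (v - u) (ω : V3))

/-- The equilibrium `μ_{δ,ρ}(v) = 1 / (δ + ρ e^{|v|²/2})`. -/
def mu (δ ρ : ℝ) (v : V3) : ℝ := 1 / (δ + ρ * Real.exp (‖v‖ ^ 2 / 2))

/-- `√μ̄_{δ,ρ}(v) = √(μ_{δ,ρ}(v) (1 - δ μ_{δ,ρ}(v)))`. -/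
def sqrtMuBar (δ ρ : ℝ) (v : V3) : ℝ := Real.sqrt (mu δ ρ v * (1 - δ * mu δ ρ v))

/-- The collision frequency `ν_δ(v)`. -/
def nu (γ : ℝ) (b : ℝ → ℝ) (δ ρ : ℝ) (v : V3) : ℝ :=
  ∫ u : V3, ∫ ω : S2,
    (let m := mu δ ρ
     let u' := postU v u ω
     let v' := postV v u ω
     kernelB γ b v u ω *
      (m u - δ * m u * m u' - δ * m u * m v' + δ * m u' * m v')) ∂sphereMeasure

/-- The linear operator `K_δ`, so that `-ν_δ + K_δ` is the linearization of the collision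
operator around the equilibrium. -/
def opK (γ : ℝ) (b : ℝ → ℝ) (δ ρ : ℝ) (f : V3 → ℝ) (v : V3) : ℝ :=
  ∫ u : V3, ∫ ω : S2,
    (let m := mu δ ρ
     let r := sqrtMuBar δ ρ
     let u' := postU v u ω
     let v' := postV v u ω
     kernelB γ b v u ω *
      (r u' / r v * (m v' - δ * m v' * m u - δ * m v' * m v + δ * m u * m v) * f u'
       + r v' / r v * (m u' - δ * m u' * m u - δ * m u' * m v + δ * m u * m v) * f v'
       - r u / r v * (m v - δ * m v * m u' - δ * m v * m v' + δ * m u' * m v') * f u))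
    ∂sphereMeasure

/-- The nonlinear operator `Γ_δ` (the quadratic and cubic terms of the collision operator
around the equilibrium). -/
def opGamma (γ : ℝ) (b : ℝ → ℝ) (δ ρ : ℝ) (f : V3 → ℝ) (v : V3) : ℝ :=
  1 / sqrtMuBar δ ρ v * ∫ u : V3, ∫ ω : S2,
    (let m := mu δ ρ
     let g := fun z : V3 => sqrtMuBar δ ρ z * f z
     let u' := postU v u ω
     let v' := postV v u ω
     kernelB γ b v u ω *
      (g u' * g v' * (1 - δ * m v - δ * m u)
       - g u * g v * (1 - δ * m v' - δ * m u')
       + δ * g v' * g u * (m v - m u')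
       + δ * g u' * g u * (m v - m v')
       + δ * g v' * g v * (m u - m u')
       + δ * g u' * g v * (m u - m v')
       + δ * g u * g v * g u'
       + δ * g u * g v * g v'
       - δ * g u' * g v' * g u
       - δ * g u' * g v' * g v)) ∂sphereMeasure

/-- The distribution function `F = μ_{δ,ρ} + √μ̄_{δ,ρ} f` with perturbation `f`, at one value
`y = f(v)`. -/
def distribution (δ ρ : ℝ) (v : V3) (y : ℝ) : ℝ := mu δ ρ v + sqrtMuBar δ ρ v * y

/-- The velocity weight `w_β(v) = (1 + |v|)^β`. -/
def weight (β : ℝ) (v : V3) : ℝ := (1 + ‖v‖) ^ β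

/-- The weighted norm `‖w_β g‖_{L^∞_{v,x}} = sup_v sup_x |w_β(v) g(x,v)|`, possibly infinite. -/
def weightedNorm (Ω : Domain) (β : ℝ) (g : Ω.Point → V3 → ℝ) : ℝ≥0∞ :=
  ⨆ (v : V3) (x : Ω.Point), ENNReal.ofReal |weight β v * g x v|

/-- The weighted norm `‖w_β f‖_{L^∞_T L^∞_{v,x}}` with the supremum over `t ∈ [0,T]`. -/
def weightedNormT (Ω : Domain) (β T : ℝ) (f : ℝ → Ω.Point → V3 → ℝ) : ℝ≥0∞ :=
  ⨆ t ∈ Icc (0 : ℝ) T, weightedNorm Ω β (f t)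

/-- `f` is a mild solution on `[0,T]` of the equation `∂ₜf + v·∇ₓf + ν_δ f - K_δ f = Γ_δ(f)`,
`f(0) = f₀`: a measurable function in `L^∞_T L^∞_{v,x}` satisfying the equation integrated along
backward trajectories. Only the values of `f` for times in `[0,T]` matter. -/
structure IsMildSolution (Ω : Domain) (γ : ℝ) (b : ℝ → ℝ) (δ ρ T : ℝ)
    (f₀ : Ω.Point → V3 → ℝ) (f : ℝ → Ω.Point → V3 → ℝ) : Prop where
  measurable : Measurable fun p : Icc (0 : ℝ) T × Ω.Point × V3 => f p.1 p.2.1 p.2.2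
  bounded : ∃ M : ℝ, ∀ t ∈ Icc (0 : ℝ) T, ∀ x v, |f t x v| ≤ M
  mild : ∀ t ∈ Icc (0 : ℝ) T, ∀ x v,
    f t x v = Real.exp (-(nu γ b δ ρ v * t)) * f₀ (Ω.back x (t • v)) v
      + (∫ s in (0 : ℝ)..t, Real.exp (-(nu γ b δ ρ v * (t - s))) *
          opK γ b δ ρ (f s (Ω.back x ((t - s) • v))) v)
      + ∫ s in (0 : ℝ)..t, Real.exp (-(nu γ b δ ρ v * (t - s))) *
          opGamma γ b δ ρ (f s (Ω.back x ((t - s) • v))) v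

end QuantumBoltzmann

end

/-!
Write `𝔤(v) = e^{-|v|²/4}` (`gauss`). Uniformly in `δ ∈ [0,1]`, and up to powers of
`2 + ρ + 1/ρ` (`gaussConst`), `√μ̄` and `1/√μ̄` are bounded by `𝔤` and `1/𝔤`, and `μ` by `𝔤²`,
while `δ μ < 1`. A collision conserves energy, so `𝔤(u') 𝔤(v') = 𝔤(u) 𝔤(v)` and
`w_β(v) ≤ w_β(u') w_β(v')`. These facts bound every coefficient in the integrands of `K_δ` and
`Γ_δ`, multiplied by `w_β(v)`, by a constant times `𝔤(u)` times the weights at the points where `f`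
is evaluated (`lin_gain_coeff` to `cubic_diag_coeff`). As `∫∫ |v - u|^γ 𝔤(u) du dω` is bounded
uniformly in `v` for `-3 < γ < 0` (`exists_kernelBound`), the source `K_δ f + Γ_δ(f)` is locally
Lipschitz in the norm with weight `w_β`, for every `β ≥ 0`, with a constant that is a function of
`ρ` times a function of `β, γ, C_b` times `1 + M + M²` on the ball of radius `M`
(`source_sub_le`). Since `ν_δ ≥ 0`, the exponential factors are at most `1`, and Picard iteration in
the ball of radius `2 ‖w_β f₀‖` converges up to the time `T₁` (`exists_solvesDuhamel`). With
`β = 0` the same bound gives uniqueness among all bounded functions (`IsMildSolution.unique`).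

To obtain `0 ≤ F` and `δ F ≤ 1`, the iteration is run with `f` replaced in the source by its
projection `clip` onto the profiles with `0 ≤ F`, `δ F ≤ 1`. The projection is `1`-Lipschitz and
fixes `0`, so it does not affect the estimates. By detailed balance, `-ν_δ f + K_δ f + Γ_δ(f)` is the
full collision operator at `F`, divided by `√μ̄` (`opK_add_opGamma_sub_nu`). Where `F < 0` the
projected density vanishes, only the gain term remains, and it is nonnegative; where `δ F > 1` only
the loss term remains, and it is nonpositive. Hence along each trajectory `F` cannot leave the
physical range (`le_of_duhamel`, `distribution_mem_of_solvesDuhamel`), the projection is inactive,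
and the solution solves the original equation.
-/

namespace QuantumBoltzmann

/-! ### Gaussian bounds for the equilibrium -/

/-- The Gaussian `e^{-|v|²/4}`, comparable with `√μ̄` uniformly in `δ ∈ [0,1]`. -/
noncomputable def gauss (v : V3) : ℝ := Real.exp (-(‖v‖ ^ 2 / 4))

/-- The constant `2 + ρ + 1/ρ = (1 + ρ)(1 + 1/ρ)` that compares the equilibrium with Gaussians. -/
noncomputable def gaussConst (ρ : ℝ) : ℝ := 2 + ρ + 1 / ρ

lemma gauss_pos (v : V3) : 0 < gauss v := Real.exp_pos _

lemma gauss_le_one (v : V3) : gauss v ≤ 1 := by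
  unfold gauss
  rw [Real.exp_le_one_iff]
  have := sq_nonneg ‖v‖
  linarith

lemma exp_eq_gauss (v : V3) : Real.exp (‖v‖ ^ 2 / 2) = (gauss v ^ 2)⁻¹ := by
  unfold gauss
  rw [← Real.exp_nat_mul, ← Real.exp_neg]
  congr 1
  push_cast
  ring

/-- Conservation of energy in a collision, in terms of the Gaussians. -/
lemma gauss_mul_gauss {v u p q : V3} (h : ‖p‖ ^ 2 + ‖q‖ ^ 2 = ‖v‖ ^ 2 + ‖u‖ ^ 2) :
    gauss p * gauss q = gauss u * gauss v := by
  unfold gauss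
  rw [← Real.exp_add, ← Real.exp_add]
  congr 1
  linarith

lemma gaussConst_one_le {ρ : ℝ} (hρ : 0 < ρ) : 1 ≤ gaussConst ρ := by
  unfold gaussConst
  have : 0 < 1 / ρ := by positivity
  linarith

section Equilibrium

variable {δ ρ : ℝ} (hδ : 0 ≤ δ) (hρ : 0 < ρ)
include hδ hρ

lemma mu_eq (v : V3) : mu δ ρ v = gauss v ^ 2 / (δ * gauss v ^ 2 + ρ) := by
  have h := gauss_pos v
  unfold mu
  rw [exp_eq_gauss]
  field_simp

lemma mu_pos (v : V3) : 0 < mu δ ρ v := by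
  rw [mu_eq hδ hρ]
  have h := gauss_pos v
  positivity

lemma one_sub_mu (v : V3) : 1 - δ * mu δ ρ v = ρ / (δ * gauss v ^ 2 + ρ) := by
  have h := gauss_pos v
  rw [mu_eq hδ hρ]
  field_simp
  ring

lemma delta_mul_mu_lt_one (v : V3) : δ * mu δ ρ v < 1 := by
  have h := gauss_pos v
  have h2 : 0 < 1 - δ * mu δ ρ v := by
    rw [one_sub_mu hδ hρ]
    positivity
  linarith

lemma sqrtMuBar_eq (v : V3) :
    sqrtMuBar δ ρ v = Real.sqrt ρ * gauss v / (δ * gauss v ^ 2 + ρ) := by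
  have h := gauss_pos v
  unfold sqrtMuBar
  rw [one_sub_mu hδ hρ, mu_eq hδ hρ]
  rw [Real.sqrt_eq_iff_mul_self_eq (by positivity) (by positivity), ← sq]
  rw [div_mul_div_comm, div_pow, mul_pow, Real.sq_sqrt hρ.le]
  ring

lemma sqrtMuBar_pos (v : V3) : 0 < sqrtMuBar δ ρ v := by
  have h := gauss_pos v
  rw [sqrtMuBar_eq hδ hρ]
  positivity

lemma mu_le (v : V3) : mu δ ρ v ≤ gaussConst ρ * gauss v ^ 2 := by
  have h := gauss_pos v
  rw [mu_eq hδ hρ, div_le_iff₀ (by positivity)]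
  have h1 : (1 : ℝ) ≤ gaussConst ρ * ρ := by
    unfold gaussConst
    have : (2 + ρ + 1 / ρ) * ρ = 2 * ρ + ρ ^ 2 + 1 := by field_simp
    rw [this]
    nlinarith
  have h2 : 0 ≤ gaussConst ρ * gauss v ^ 2 * (δ * gauss v ^ 2) := by
    have := gaussConst_one_le hρ
    positivity
  nlinarith [sq_nonneg (gauss v)]

lemma sqrtMuBar_le (v : V3) : sqrtMuBar δ ρ v ≤ gaussConst ρ * gauss v := by
  have h := gauss_pos v
  have hs := Real.sqrt_pos.2 hρ
  have hss := Real.sq_sqrt hρ.le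
  rw [sqrtMuBar_eq hδ hρ, div_le_iff₀ (by positivity)]
  have h1 : Real.sqrt ρ ≤ gaussConst ρ * ρ := by
    unfold gaussConst
    have : (2 + ρ + 1 / ρ) * ρ = 2 * ρ + ρ ^ 2 + 1 := by field_simp
    rw [this]
    nlinarith [sq_nonneg (Real.sqrt ρ - 1)]
  have h2 : 0 ≤ gaussConst ρ * gauss v * (δ * gauss v ^ 2) := by
    have := gaussConst_one_le hρ
    positivity
  nlinarith

lemma one_div_sqrtMuBar_le (hδ1 : δ ≤ 1) (v : V3) :
    1 / sqrtMuBar δ ρ v ≤ gaussConst ρ / gauss v := by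
  have h := gauss_pos v
  have h' := gauss_le_one v
  have hs := Real.sqrt_pos.2 hρ
  have hss := Real.sq_sqrt hρ.le
  rw [sqrtMuBar_eq hδ hρ, one_div_div, div_le_div_iff₀ (by positivity) (by positivity)]
  have h1 : δ * gauss v ^ 2 + ρ ≤ 1 + ρ := by nlinarith [sq_nonneg (gauss v)]
  have h2 : 1 + ρ ≤ gaussConst ρ * Real.sqrt ρ := by
    have h3 : gaussConst ρ = (1 + ρ) * (1 + 1 / ρ) := by
      unfold gaussConst; field_simp; ring
    rw [h3, mul_assoc]
    have h4 : 1 ≤ (1 + 1 / ρ) * Real.sqrt ρ := by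
      have h5 : 1 / ρ = 1 / Real.sqrt ρ ^ 2 := by rw [hss]
      rw [h5]
      have h6 : (1 + 1 / Real.sqrt ρ ^ 2) * Real.sqrt ρ = Real.sqrt ρ + 1 / Real.sqrt ρ := by
        field_simp
      rw [h6, ← sub_nonneg]
      have h7 : Real.sqrt ρ + 1 / Real.sqrt ρ - 1
          = ((Real.sqrt ρ - 1) ^ 2 + Real.sqrt ρ) / Real.sqrt ρ := by field_simp; ring
      rw [h7]; positivity
    nlinarith
  calc (δ * gauss v ^ 2 + ρ) * gauss v ≤ (gaussConst ρ * Real.sqrt ρ) * gauss v := by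
        gcongr; linarith
    _ = _ := by ring

/-- Detailed balance: `μ` makes the collision operator vanish, since `μ / (1 - δ μ)` is a multiple
of a Gaussian. -/
lemma detailed_balance {v u p q : V3} (h : ‖p‖ ^ 2 + ‖q‖ ^ 2 = ‖v‖ ^ 2 + ‖u‖ ^ 2) :
    mu δ ρ p * mu δ ρ q * (1 - δ * mu δ ρ v) * (1 - δ * mu δ ρ u)
      = mu δ ρ v * mu δ ρ u * (1 - δ * mu δ ρ p) * (1 - δ * mu δ ρ q) := by
  have hg := gauss_mul_gauss h
  have hv := gauss_pos v
  have hu := gauss_pos u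
  have hp := gauss_pos p
  have hq := gauss_pos q
  simp only [one_sub_mu hδ hρ]
  simp only [mu_eq hδ hρ]
  field_simp
  rw [← mul_pow, hg]
  ring

end Equilibrium

/-! ### The velocity weight -/

lemma one_le_weight {β : ℝ} (hβ : 0 ≤ β) (v : V3) : 1 ≤ weight β v :=
  Real.one_le_rpow (by linarith [norm_nonneg v]) hβ

lemma weight_le_mul {β : ℝ} (hβ : 0 ≤ β) {v u p q : V3}
    (h : ‖p‖ ^ 2 + ‖q‖ ^ 2 = ‖v‖ ^ 2 + ‖u‖ ^ 2) :
    weight β v ≤ weight β p * weight β q := by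
  unfold weight
  have hp := norm_nonneg p
  have hq := norm_nonneg q
  rw [← Real.mul_rpow (by positivity) (by positivity)]
  apply Real.rpow_le_rpow (by positivity) _ hβ
  have h1 : ‖v‖ ≤ ‖p‖ + ‖q‖ := by
    apply le_of_sq_le_sq _ (by positivity)
    nlinarith [sq_nonneg ‖u‖, mul_nonneg hp hq]
  nlinarith [mul_nonneg hp hq]

lemma exists_weight_mul_gauss_le (β : ℝ) :
    ∃ W : ℝ, 1 ≤ W ∧ ∀ v, weight β v * gauss v ≤ W := by
  obtain ⟨n, hn⟩ := exists_nat_ge β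
  -- `(1+t)^n ≤ n! e^{1+t}` and `t ≤ t²/4 + 1`
  refine ⟨max 1 (n.factorial * Real.exp 2), le_max_left _ _, fun v => le_trans ?_ (le_max_right _ _)⟩
  have hv := norm_nonneg v
  have h1 : weight β v ≤ (1 + ‖v‖) ^ n := by
    unfold weight
    rw [← Real.rpow_natCast]
    exact Real.rpow_le_rpow_of_exponent_le (by linarith) hn
  have h2 : (1 + ‖v‖) ^ n ≤ n.factorial * Real.exp (1 + ‖v‖) := by
    have := Real.pow_div_factorial_le_exp (1 + ‖v‖) (by positivity) n
    rw [div_le_iff₀ (by positivity)] at this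
    linarith
  calc weight β v * gauss v ≤ (n.factorial * Real.exp (1 + ‖v‖)) * gauss v := by
        gcongr
        · exact (gauss_pos v).le
        · exact h1.trans h2
    _ = n.factorial * Real.exp (1 + ‖v‖ + -(‖v‖ ^ 2 / 4)) := by
        unfold gauss; rw [Real.exp_add (1 + ‖v‖)]; ring
    _ ≤ n.factorial * Real.exp 2 := by
        gcongr
        nlinarith [sq_nonneg (‖v‖ / 2 - 1)]

/-! ### Pointwise bounds for the collision integrands -/

/-- The integrand of `K_δ f(v)` without the kernel `B`, with `p`, `q` in place of the
post-collision velocities `v'`, `u'`. -/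
noncomputable def linDensity (δ ρ : ℝ) (f : V3 → ℝ) (v u p q : V3) : ℝ :=
  let m := mu δ ρ
  let r := sqrtMuBar δ ρ
  r q / r v * (m p - δ * m p * m u - δ * m p * m v + δ * m u * m v) * f q
    + r p / r v * (m q - δ * m q * m u - δ * m q * m v + δ * m u * m v) * f p
    - r u / r v * (m v - δ * m v * m q - δ * m v * m p + δ * m q * m p) * f u

/-- The integrand of `√μ̄(v) Γ_δ(f)(v)` without the kernel `B`, with `p`, `q` in place of the
post-collision velocities `v'`, `u'`. -/
noncomputable def nonlinDensity (δ ρ : ℝ) (f : V3 → ℝ) (v u p q : V3) : ℝ :=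
  let m := mu δ ρ
  let g := fun z : V3 => sqrtMuBar δ ρ z * f z
  g q * g p * (1 - δ * m v - δ * m u)
    - g u * g v * (1 - δ * m p - δ * m q)
    + δ * g p * g u * (m v - m q)
    + δ * g q * g u * (m v - m p)
    + δ * g p * g v * (m u - m q)
    + δ * g q * g v * (m u - m p)
    + δ * g u * g v * g q
    + δ * g u * g v * g p
    - δ * g q * g p * g u
    - δ * g q * g p * g v

section Coefficients

variable {β δ ρ W : ℝ} (hβ : 0 ≤ β) (hδ : 0 ≤ δ) (hδ1 : δ ≤ 1) (hρ : 0 < ρ) (hW1 : 1 ≤ W)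
  (hW : ∀ z, weight β z * gauss z ≤ W)
  {v u p q : V3} (h : ‖p‖ ^ 2 + ‖q‖ ^ 2 = ‖v‖ ^ 2 + ‖u‖ ^ 2)

lemma one_sub_add_abs_le {x y : ℝ} (hx : 0 ≤ x) (hx1 : x ≤ 1) (hy : 0 ≤ y) (hy1 : y ≤ 1) :
    |1 - x - y| ≤ 1 := by
  rw [abs_le]; constructor <;> linarith

lemma delta_sub_abs_le {δ x y : ℝ} (hδ : 0 ≤ δ) (hδ1 : δ ≤ 1) (hx : 0 ≤ x) (hy : 0 ≤ y) :
    |δ * (x - y)| ≤ x + y := by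
  rw [abs_mul, abs_of_nonneg hδ]
  have : |x - y| ≤ x + y := by rw [abs_le]; constructor <;> linarith
  nlinarith [abs_nonneg (x - y)]

include hβ hδ hδ1 hρ hW1 hW h

/-- Coefficient of `f(q)` in the linear integrand; the two gain terms of `K_δ` are exchanged by
swapping `p` and `q`. -/
lemma lin_gain_coeff :
    weight β v * |sqrtMuBar δ ρ q / sqrtMuBar δ ρ v * (mu δ ρ p - δ * mu δ ρ p * mu δ ρ u
      - δ * mu δ ρ p * mu δ ρ v + δ * mu δ ρ u * mu δ ρ v)|
      ≤ 2 * gaussConst ρ ^ 4 * W * gauss u * weight β q := by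
  have hS := gaussConst_one_le hρ
  have hg := gauss_mul_gauss h
  have hwv : weight β v ≤ weight β p * weight β q := weight_le_mul hβ h
  have hwq := one_le_weight hβ q
  have hwv1 := one_le_weight hβ v
  have Xv := gauss_pos v; have Xu := gauss_pos u; have Xp := gauss_pos p; have Xq := gauss_pos q
  have Xu1 := gauss_le_one u; have Xq1 := gauss_le_one q
  have mp := mu_pos hδ hρ p; have mu' := mu_pos hδ hρ u; have mv := mu_pos hδ hρ v
  have hs := one_div_sqrtMuBar_le hδ hρ hδ1 v
  have hrv := sqrtMuBar_pos hδ hρ v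
  have hrq := sqrtMuBar_pos hδ hρ q
  have ha : sqrtMuBar δ ρ q * (1 / sqrtMuBar δ ρ v) * mu δ ρ p
      ≤ gaussConst ρ ^ 4 * gauss u * gauss p := by
    calc _ ≤ (gaussConst ρ * gauss q) * (gaussConst ρ / gauss v) * (gaussConst ρ * gauss p ^ 2) := by
          gcongr
          · exact sqrtMuBar_le hδ hρ q
          · exact mu_le hδ hρ p
      _ = gaussConst ρ ^ 3 * ((gauss p * gauss q) / gauss v) * gauss p := by field_simp
      _ = gaussConst ρ ^ 3 * gauss u * gauss p := by rw [hg]; field_simp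
      _ ≤ gaussConst ρ ^ 4 * gauss u * gauss p := by gcongr; norm_num
  have hb : sqrtMuBar δ ρ q * (1 / sqrtMuBar δ ρ v) * (mu δ ρ u * mu δ ρ v)
      ≤ gaussConst ρ ^ 4 * gauss u * gauss v := by
    calc _ ≤ (gaussConst ρ * gauss q) * (gaussConst ρ / gauss v) *
          ((gaussConst ρ * gauss u ^ 2) * (gaussConst ρ * gauss v ^ 2)) := by
          gcongr
          · exact sqrtMuBar_le hδ hρ q
          · exact mu_le hδ hρ u
          · exact mu_le hδ hρ v
      _ = gaussConst ρ ^ 4 * (gauss q * gauss u) * gauss u * gauss v := by field_simp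
      _ ≤ gaussConst ρ ^ 4 * 1 * gauss u * gauss v := by
          gcongr
          nlinarith
      _ = _ := by ring
  have hpar : |mu δ ρ p - δ * mu δ ρ p * mu δ ρ u - δ * mu δ ρ p * mu δ ρ v
      + δ * mu δ ρ u * mu δ ρ v| ≤ mu δ ρ p + mu δ ρ u * mu δ ρ v := by
    have h1 := one_sub_add_abs_le (mul_nonneg hδ mu'.le) (delta_mul_mu_lt_one hδ hρ u).le
      (mul_nonneg hδ mv.le) (delta_mul_mu_lt_one hδ hρ v).le
    have h2 : mu δ ρ p - δ * mu δ ρ p * mu δ ρ u - δ * mu δ ρ p * mu δ ρ v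
      + δ * mu δ ρ u * mu δ ρ v = mu δ ρ p * (1 - δ * mu δ ρ u - δ * mu δ ρ v)
        + δ * (mu δ ρ u * mu δ ρ v) := by ring
    rw [h2]
    refine (abs_add_le _ _).trans (add_le_add ?_ ?_)
    · rw [abs_mul, abs_of_pos mp]
      nlinarith
    · have := mul_pos mu' mv
      rw [abs_of_nonneg (by positivity)]
      nlinarith
  rw [abs_mul, abs_of_pos (div_pos hrq hrv)]
  have hWv : weight β v * gauss v ≤ W * weight β q := (hW v).trans (by nlinarith)
  have hWp : weight β v * gauss p ≤ W * weight β q := by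
    calc weight β v * gauss p ≤ (weight β p * weight β q) * gauss p := by gcongr
      _ = (weight β p * gauss p) * weight β q := by ring
      _ ≤ W * weight β q := by gcongr; exact hW p
  have hSu : 0 ≤ gaussConst ρ ^ 4 * gauss u := by positivity
  calc _ ≤ weight β v * (sqrtMuBar δ ρ q / sqrtMuBar δ ρ v * (mu δ ρ p + mu δ ρ u * mu δ ρ v)) := by
        gcongr
    _ = weight β v * (sqrtMuBar δ ρ q * (1 / sqrtMuBar δ ρ v) * mu δ ρ p
          + sqrtMuBar δ ρ q * (1 / sqrtMuBar δ ρ v) * (mu δ ρ u * mu δ ρ v)) := by ring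
    _ ≤ weight β v * (gaussConst ρ ^ 4 * gauss u * gauss p + gaussConst ρ ^ 4 * gauss u * gauss v) := by
        gcongr
    _ = gaussConst ρ ^ 4 * gauss u * (weight β v * gauss p)
          + gaussConst ρ ^ 4 * gauss u * (weight β v * gauss v) := by ring
    _ ≤ gaussConst ρ ^ 4 * gauss u * (W * weight β q)
          + gaussConst ρ ^ 4 * gauss u * (W * weight β q) := by gcongr
    _ = _ := by ring

/-- Coefficient of `f(u)` in the linear integrand. -/
lemma lin_loss_coeff :
    weight β v * |sqrtMuBar δ ρ u / sqrtMuBar δ ρ v * (mu δ ρ v - δ * mu δ ρ v * mu δ ρ q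
      - δ * mu δ ρ v * mu δ ρ p + δ * mu δ ρ q * mu δ ρ p)|
      ≤ 2 * gaussConst ρ ^ 4 * W * gauss u * weight β u := by
  have hS := gaussConst_one_le hρ
  have hg := gauss_mul_gauss h
  have hwu := one_le_weight hβ u
  have hwv1 := one_le_weight hβ v
  have Xv := gauss_pos v; have Xu := gauss_pos u; have Xp := gauss_pos p; have Xq := gauss_pos q
  have Xu1 := gauss_le_one u; have Xq1 := gauss_le_one q
  have mp := mu_pos hδ hρ p; have mq := mu_pos hδ hρ q; have mv := mu_pos hδ hρ v
  have hs := one_div_sqrtMuBar_le hδ hρ hδ1 v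
  have hrv := sqrtMuBar_pos hδ hρ v
  have hru := sqrtMuBar_pos hδ hρ u
  have ha : sqrtMuBar δ ρ u * (1 / sqrtMuBar δ ρ v) * mu δ ρ v
      ≤ gaussConst ρ ^ 4 * gauss u * gauss v := by
    calc _ ≤ (gaussConst ρ * gauss u) * (gaussConst ρ / gauss v) * (gaussConst ρ * gauss v ^ 2) := by
          gcongr
          · exact sqrtMuBar_le hδ hρ u
          · exact mu_le hδ hρ v
      _ = gaussConst ρ ^ 3 * gauss u * gauss v := by field_simp
      _ ≤ gaussConst ρ ^ 4 * gauss u * gauss v := by gcongr; norm_num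
  have hb : sqrtMuBar δ ρ u * (1 / sqrtMuBar δ ρ v) * (mu δ ρ q * mu δ ρ p)
      ≤ gaussConst ρ ^ 4 * gauss u * gauss v := by
    calc _ ≤ (gaussConst ρ * gauss u) * (gaussConst ρ / gauss v) *
          ((gaussConst ρ * gauss q ^ 2) * (gaussConst ρ * gauss p ^ 2)) := by
          gcongr
          · exact sqrtMuBar_le hδ hρ u
          · exact mu_le hδ hρ q
          · exact mu_le hδ hρ p
      _ = gaussConst ρ ^ 4 * gauss u * (gauss p * gauss q) ^ 2 / gauss v := by field_simp
      _ = gaussConst ρ ^ 4 * (gauss u * gauss u) * gauss u * gauss v := by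
          rw [hg]; field_simp
      _ ≤ gaussConst ρ ^ 4 * 1 * gauss u * gauss v := by
          gcongr
          nlinarith
      _ = _ := by ring
  have hpar : |mu δ ρ v - δ * mu δ ρ v * mu δ ρ q - δ * mu δ ρ v * mu δ ρ p
      + δ * mu δ ρ q * mu δ ρ p| ≤ mu δ ρ v + mu δ ρ q * mu δ ρ p := by
    have h1 := one_sub_add_abs_le (mul_nonneg hδ mq.le) (delta_mul_mu_lt_one hδ hρ q).le
      (mul_nonneg hδ mp.le) (delta_mul_mu_lt_one hδ hρ p).le
    have h2 : mu δ ρ v - δ * mu δ ρ v * mu δ ρ q - δ * mu δ ρ v * mu δ ρ p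
      + δ * mu δ ρ q * mu δ ρ p = mu δ ρ v * (1 - δ * mu δ ρ q - δ * mu δ ρ p)
        + δ * (mu δ ρ q * mu δ ρ p) := by ring
    rw [h2]
    refine (abs_add_le _ _).trans (add_le_add ?_ ?_)
    · rw [abs_mul, abs_of_pos mv]
      nlinarith
    · have := mul_pos mq mp
      rw [abs_of_nonneg (by positivity)]
      nlinarith
  rw [abs_mul, abs_of_pos (div_pos hru hrv)]
  have hWv : weight β v * gauss v ≤ W * weight β u := (hW v).trans (by nlinarith)
  have hSu : 0 ≤ gaussConst ρ ^ 4 * gauss u := by positivity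
  calc _ ≤ weight β v * (sqrtMuBar δ ρ u / sqrtMuBar δ ρ v * (mu δ ρ v + mu δ ρ q * mu δ ρ p)) := by
        gcongr
    _ = weight β v * (sqrtMuBar δ ρ u * (1 / sqrtMuBar δ ρ v) * mu δ ρ v
          + sqrtMuBar δ ρ u * (1 / sqrtMuBar δ ρ v) * (mu δ ρ q * mu δ ρ p)) := by ring
    _ ≤ weight β v * (gaussConst ρ ^ 4 * gauss u * gauss v + gaussConst ρ ^ 4 * gauss u * gauss v) := by
        gcongr
    _ = 2 * (gaussConst ρ ^ 4 * gauss u) * (weight β v * gauss v) := by ring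
    _ ≤ 2 * (gaussConst ρ ^ 4 * gauss u) * (W * weight β u) := by gcongr
    _ = _ := by ring

omit hW in
/-- Coefficient of `f(q) f(p)`. -/
lemma quad_gain_coeff :
    weight β v * |1 / sqrtMuBar δ ρ v * (sqrtMuBar δ ρ q * sqrtMuBar δ ρ p
      * (1 - δ * mu δ ρ v - δ * mu δ ρ u))|
      ≤ 2 * gaussConst ρ ^ 4 * W * gauss u * (weight β q * weight β p) := by
  have hS := gaussConst_one_le hρ
  have hg := gauss_mul_gauss h
  have hwv : weight β v ≤ weight β p * weight β q := weight_le_mul hβ h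
  have hwv1 := one_le_weight hβ v
  have hwp := one_le_weight hβ p; have hwq := one_le_weight hβ q
  have Xv := gauss_pos v; have Xu := gauss_pos u; have Xp := gauss_pos p; have Xq := gauss_pos q
  have mu' := mu_pos hδ hρ u; have mv := mu_pos hδ hρ v
  have hs := one_div_sqrtMuBar_le hδ hρ hδ1 v
  have hrv := sqrtMuBar_pos hδ hρ v
  have hrq := sqrtMuBar_pos hδ hρ q
  have hrp := sqrtMuBar_pos hδ hρ p
  have h1 := one_sub_add_abs_le (mul_nonneg hδ mv.le) (delta_mul_mu_lt_one hδ hρ v).le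
    (mul_nonneg hδ mu'.le) (delta_mul_mu_lt_one hδ hρ u).le
  rw [abs_mul, abs_mul, abs_of_pos (mul_pos hrq hrp), abs_of_pos (one_div_pos.2 hrv)]
  calc _ ≤ (weight β p * weight β q) * ((gaussConst ρ / gauss v) *
        ((gaussConst ρ * gauss q) * (gaussConst ρ * gauss p) * 1)) := by
        gcongr
        · exact sqrtMuBar_le hδ hρ q
        · exact sqrtMuBar_le hδ hρ p
    _ = (weight β p * weight β q) * (gaussConst ρ ^ 3 * ((gauss p * gauss q) / gauss v)) := by
        field_simp
    _ = 1 * gaussConst ρ ^ 3 * 1 * gauss u * (weight β q * weight β p) := by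
        rw [hg]; field_simp
    _ ≤ 2 * gaussConst ρ ^ 4 * W * gauss u * (weight β q * weight β p) := by
        gcongr <;> norm_num

omit hδ1 hW h in
/-- Coefficient of `f(u) f(v)`. -/
lemma quad_loss_coeff :
    weight β v * |1 / sqrtMuBar δ ρ v * (sqrtMuBar δ ρ u * sqrtMuBar δ ρ v
      * (1 - δ * mu δ ρ p - δ * mu δ ρ q))|
      ≤ 2 * gaussConst ρ ^ 4 * W * gauss u * (weight β u * weight β v) := by
  have hS := gaussConst_one_le hρ
  have hwu := one_le_weight hβ u
  have hwv1 := one_le_weight hβ v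
  have Xu := gauss_pos u
  have mp := mu_pos hδ hρ p; have mq := mu_pos hδ hρ q
  have hrv := sqrtMuBar_pos hδ hρ v
  have hru := sqrtMuBar_pos hδ hρ u
  have h1 := one_sub_add_abs_le (mul_nonneg hδ mp.le) (delta_mul_mu_lt_one hδ hρ p).le
    (mul_nonneg hδ mq.le) (delta_mul_mu_lt_one hδ hρ q).le
  have h2 : 1 / sqrtMuBar δ ρ v * (sqrtMuBar δ ρ u * sqrtMuBar δ ρ v
      * (1 - δ * mu δ ρ p - δ * mu δ ρ q)) = sqrtMuBar δ ρ u * (1 - δ * mu δ ρ p - δ * mu δ ρ q) := by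
    field_simp
  rw [h2, abs_mul, abs_of_pos hru]
  calc _ ≤ weight β v * ((gaussConst ρ * gauss u) * 1) := by
        gcongr
        exact sqrtMuBar_le hδ hρ u
    _ = 1 * gaussConst ρ ^ 1 * 1 * gauss u * (1 * weight β v) := by ring
    _ ≤ 2 * gaussConst ρ ^ 4 * W * gauss u * (weight β u * weight β v) := by
        gcongr <;> norm_num

/-- Coefficient of `f(p) f(u)`. -/
lemma quad_mixed_coeff :
    weight β v * |1 / sqrtMuBar δ ρ v * (sqrtMuBar δ ρ p * sqrtMuBar δ ρ u
      * (δ * (mu δ ρ v - mu δ ρ q)))|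
      ≤ 2 * gaussConst ρ ^ 4 * W * gauss u * (weight β p * weight β u) := by
  have hS := gaussConst_one_le hρ
  have hg := gauss_mul_gauss h
  have hwv : weight β v ≤ weight β p * weight β q := weight_le_mul hβ h
  have hwp := one_le_weight hβ p
  have hwu := one_le_weight hβ u
  have hwv1 := one_le_weight hβ v
  have Xv := gauss_pos v; have Xu := gauss_pos u; have Xp := gauss_pos p; have Xq := gauss_pos q
  have Xu1 := gauss_le_one u; have Xp1 := gauss_le_one p
  have mq := mu_pos hδ hρ q; have mv := mu_pos hδ hρ v
  have hs := one_div_sqrtMuBar_le hδ hρ hδ1 v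
  have hrv := sqrtMuBar_pos hδ hρ v
  have hrp := sqrtMuBar_pos hδ hρ p
  have hru := sqrtMuBar_pos hδ hρ u
  have h1 := delta_sub_abs_le hδ hδ1 mv.le mq.le
  rw [abs_mul, abs_mul, abs_of_pos (mul_pos hrp hru), abs_of_pos (one_div_pos.2 hrv)]
  have hWv : weight β v * gauss v ≤ W * (weight β p * weight β u) :=
    (hW v).trans (by nlinarith [mul_le_mul hwp hwu zero_le_one (by linarith)])
  have hWq : weight β v * gauss q ≤ W * (weight β p * weight β u) := by
    calc weight β v * gauss q ≤ (weight β p * weight β q) * gauss q := by gcongr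
      _ = (weight β q * gauss q) * (weight β p * 1) := by ring
      _ ≤ W * (weight β p * weight β u) := by gcongr; exact hW q
  have hSu : 0 ≤ gaussConst ρ ^ 4 * gauss u := by positivity
  calc _ ≤ weight β v * ((gaussConst ρ / gauss v) * ((gaussConst ρ * gauss p) * (gaussConst ρ * gauss u) *
        (gaussConst ρ * gauss v ^ 2 + gaussConst ρ * gauss q ^ 2))) := by
        gcongr
        · exact sqrtMuBar_le hδ hρ p
        · exact sqrtMuBar_le hδ hρ u
        · refine h1.trans (add_le_add (mu_le hδ hρ v) (mu_le hδ hρ q))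
    _ = gaussConst ρ ^ 4 * gauss u * (weight β v * gauss v) * gauss p
        + gaussConst ρ ^ 4 * gauss u * (weight β v * gauss q) * ((gauss p * gauss q) / gauss v) := by
        field_simp
    _ = gaussConst ρ ^ 4 * gauss u * (weight β v * gauss v) * gauss p
        + gaussConst ρ ^ 4 * gauss u * (weight β v * gauss q) * gauss u := by
        rw [hg]; field_simp
    _ ≤ gaussConst ρ ^ 4 * gauss u * (W * (weight β p * weight β u)) * 1
        + gaussConst ρ ^ 4 * gauss u * (W * (weight β p * weight β u)) * 1 := by
        gcongr
    _ = _ := by ring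

omit hW in
/-- Coefficient of `f(p) f(v)`. -/
lemma quad_diag_coeff :
    weight β v * |1 / sqrtMuBar δ ρ v * (sqrtMuBar δ ρ p * sqrtMuBar δ ρ v
      * (δ * (mu δ ρ u - mu δ ρ q)))|
      ≤ 2 * gaussConst ρ ^ 4 * W * gauss u * (weight β p * weight β v) := by
  have hS := gaussConst_one_le hρ
  have hg := gauss_mul_gauss h
  have hwp := one_le_weight hβ p
  have hwv1 := one_le_weight hβ v
  have Xv := gauss_pos v; have Xu := gauss_pos u; have Xp := gauss_pos p; have Xq := gauss_pos q
  have Xu1 := gauss_le_one u; have Xp1 := gauss_le_one p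
  have Xv1 := gauss_le_one v; have Xq1 := gauss_le_one q
  have mq := mu_pos hδ hρ q; have mu' := mu_pos hδ hρ u
  have hrv := sqrtMuBar_pos hδ hρ v
  have hrp := sqrtMuBar_pos hδ hρ p
  have h1 := delta_sub_abs_le hδ hδ1 mu'.le mq.le
  have h2 : 1 / sqrtMuBar δ ρ v * (sqrtMuBar δ ρ p * sqrtMuBar δ ρ v
      * (δ * (mu δ ρ u - mu δ ρ q))) = sqrtMuBar δ ρ p * (δ * (mu δ ρ u - mu δ ρ q)) := by
    field_simp
  rw [h2, abs_mul, abs_of_pos hrp]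
  calc _ ≤ weight β v * ((gaussConst ρ * gauss p) *
        (gaussConst ρ * gauss u ^ 2 + gaussConst ρ * gauss q ^ 2)) := by
        gcongr
        · exact sqrtMuBar_le hδ hρ p
        · refine h1.trans (add_le_add (mu_le hδ hρ u) (mu_le hδ hρ q))
    _ = weight β v * (gaussConst ρ ^ 2 * (gauss u * (gauss p * gauss u) + (gauss p * gauss q) * gauss q)) := by
        ring
    _ = weight β v * (gaussConst ρ ^ 2 * (gauss u * (gauss p * gauss u) + gauss u * (gauss v * gauss q))) := by
        rw [hg]; ring
    _ ≤ weight β v * (gaussConst ρ ^ 2 * (gauss u * 1 + gauss u * 1)) := by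
        gcongr
        · nlinarith
        · nlinarith
    _ = 2 * gaussConst ρ ^ 2 * 1 * gauss u * (1 * weight β v) := by ring
    _ ≤ 2 * gaussConst ρ ^ 4 * W * gauss u * (weight β p * weight β v) := by
        gcongr; norm_num

omit hW h in
/-- Coefficient of `f(u) f(v) f(q)`. -/
lemma cubic_loss_coeff :
    weight β v * |1 / sqrtMuBar δ ρ v * (δ * sqrtMuBar δ ρ u * sqrtMuBar δ ρ v * sqrtMuBar δ ρ q)|
      ≤ 2 * gaussConst ρ ^ 4 * W * gauss u * (weight β u * weight β v * weight β q) := by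
  have hS := gaussConst_one_le hρ
  have hwu := one_le_weight hβ u
  have hwq := one_le_weight hβ q
  have hwv1 := one_le_weight hβ v
  have Xu := gauss_pos u; have Xq := gauss_pos q
  have Xq1 := gauss_le_one q
  have hrv := sqrtMuBar_pos hδ hρ v
  have hrq := sqrtMuBar_pos hδ hρ q
  have hru := sqrtMuBar_pos hδ hρ u
  have h2 : 1 / sqrtMuBar δ ρ v * (δ * sqrtMuBar δ ρ u * sqrtMuBar δ ρ v * sqrtMuBar δ ρ q)
      = δ * sqrtMuBar δ ρ u * sqrtMuBar δ ρ q := by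
    field_simp
  rw [h2, abs_of_nonneg (by positivity)]
  calc _ ≤ weight β v * (1 * (gaussConst ρ * gauss u) * (gaussConst ρ * 1)) := by
        gcongr
        · exact sqrtMuBar_le hδ hρ u
        · refine (sqrtMuBar_le hδ hρ q).trans (by gcongr)
    _ = 1 * gaussConst ρ ^ 2 * 1 * gauss u * (1 * weight β v * 1) := by ring
    _ ≤ 2 * gaussConst ρ ^ 4 * W * gauss u * (weight β u * weight β v * weight β q) := by
        gcongr <;> norm_num

omit hW in
/-- Coefficient of `f(q) f(p) f(u)`. -/
lemma cubic_gain_coeff :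
    weight β v * |1 / sqrtMuBar δ ρ v * (δ * sqrtMuBar δ ρ q * sqrtMuBar δ ρ p * sqrtMuBar δ ρ u)|
      ≤ 2 * gaussConst ρ ^ 4 * W * gauss u * (weight β q * weight β p * weight β u) := by
  have hS := gaussConst_one_le hρ
  have hg := gauss_mul_gauss h
  have hwv : weight β v ≤ weight β q * weight β p := by
    rw [mul_comm]; exact weight_le_mul hβ h
  have hwu := one_le_weight hβ u
  have hwq := one_le_weight hβ q
  have hwp := one_le_weight hβ p
  have hwv1 := one_le_weight hβ v
  have Xv := gauss_pos v; have Xu := gauss_pos u; have Xp := gauss_pos p; have Xq := gauss_pos q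
  have Xu1 := gauss_le_one u
  have hs := one_div_sqrtMuBar_le hδ hρ hδ1 v
  have hrv := sqrtMuBar_pos hδ hρ v
  have hrq := sqrtMuBar_pos hδ hρ q
  have hrp := sqrtMuBar_pos hδ hρ p
  have hru := sqrtMuBar_pos hδ hρ u
  rw [abs_of_nonneg (by positivity)]
  calc _ ≤ (weight β q * weight β p) * ((gaussConst ρ / gauss v) *
          (1 * (gaussConst ρ * gauss q) * (gaussConst ρ * gauss p) * (gaussConst ρ * gauss u))) := by
        gcongr
        · exact sqrtMuBar_le hδ hρ q
        · exact sqrtMuBar_le hδ hρ p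
        · exact sqrtMuBar_le hδ hρ u
    _ = (weight β q * weight β p) * (gaussConst ρ ^ 4 * gauss u * ((gauss p * gauss q) / gauss v)) := by
        field_simp
    _ = 1 * gaussConst ρ ^ 4 * gauss u * gauss u * (weight β q * weight β p * 1) := by
        rw [hg]; field_simp
    _ ≤ 2 * gaussConst ρ ^ 4 * W * gauss u * (weight β q * weight β p * weight β u) := by
        have : gauss u ≤ W := Xu1.trans hW1
        gcongr; norm_num

omit hW in
/-- Coefficient of `f(q) f(p) f(v)`. -/
lemma cubic_diag_coeff :
    weight β v * |1 / sqrtMuBar δ ρ v * (δ * sqrtMuBar δ ρ q * sqrtMuBar δ ρ p * sqrtMuBar δ ρ v)|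
      ≤ 2 * gaussConst ρ ^ 4 * W * gauss u * (weight β q * weight β p * weight β v) := by
  have hS := gaussConst_one_le hρ
  have hg := gauss_mul_gauss h
  have hwq := one_le_weight hβ q
  have hwp := one_le_weight hβ p
  have hwv1 := one_le_weight hβ v
  have Xv := gauss_pos v; have Xu := gauss_pos u; have Xp := gauss_pos p; have Xq := gauss_pos q
  have Xv1 := gauss_le_one v
  have hrv := sqrtMuBar_pos hδ hρ v
  have hrq := sqrtMuBar_pos hδ hρ q
  have hrp := sqrtMuBar_pos hδ hρ p
  have h2 : 1 / sqrtMuBar δ ρ v * (δ * sqrtMuBar δ ρ q * sqrtMuBar δ ρ p * sqrtMuBar δ ρ v)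
      = δ * sqrtMuBar δ ρ q * sqrtMuBar δ ρ p := by
    field_simp
  rw [h2, abs_of_nonneg (by positivity)]
  calc _ ≤ weight β v * (1 * (gaussConst ρ * gauss q) * (gaussConst ρ * gauss p)) := by
        gcongr
        · exact sqrtMuBar_le hδ hρ q
        · exact sqrtMuBar_le hδ hρ p
    _ = weight β v * (gaussConst ρ ^ 2 * (gauss p * gauss q)) := by ring
    _ = 1 * gaussConst ρ ^ 2 * gauss v * gauss u * (1 * 1 * weight β v) := by rw [hg]; ring
    _ ≤ 2 * gaussConst ρ ^ 4 * W * gauss u * (weight β q * weight β p * weight β v) := by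
        have : gauss v ≤ W := Xv1.trans hW1
        gcongr <;> norm_num

end Coefficients

/-! ### Lipschitz bounds for the collision integrands -/

lemma weighted_lipschitz_one {wv w c κ x y D : ℝ} (hwv : 0 ≤ wv) (hw : 0 ≤ w) (hκ : 0 ≤ κ)
    (hc : wv * |c| ≤ κ * w) (hD : |w * (x - y)| ≤ D) :
    |wv * (c * x - c * y)| ≤ κ * D := by
  calc |wv * (c * x - c * y)| = (wv * |c|) * |x - y| := by
        rw [← mul_sub, abs_mul, abs_mul, abs_of_nonneg hwv, mul_assoc]
    _ ≤ (κ * w) * |x - y| := by gcongr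
    _ = κ * |w * (x - y)| := by rw [abs_mul, abs_of_nonneg hw, mul_assoc]
    _ ≤ κ * D := by gcongr

lemma weighted_lipschitz_two {wv w₁ w₂ c κ x₁ x₂ y₁ y₂ M D : ℝ} (hwv : 0 ≤ wv) (hκ : 0 ≤ κ)
    (hw₁ : 0 ≤ w₁) (hw₂ : 0 ≤ w₂) (hc : wv * |c| ≤ κ * (w₁ * w₂))
    (hx₂ : |w₂ * x₂| ≤ M) (hy₁ : |w₁ * y₁| ≤ M)
    (hD₁ : |w₁ * (x₁ - y₁)| ≤ D) (hD₂ : |w₂ * (x₂ - y₂)| ≤ D) :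
    |wv * (c * (x₁ * x₂) - c * (y₁ * y₂))| ≤ κ * (2 * M * D) := by
  refine weighted_lipschitz_one hwv (mul_nonneg hw₁ hw₂) hκ hc ?_
  have h : w₁ * w₂ * (x₁ * x₂ - y₁ * y₂)
      = (w₁ * (x₁ - y₁)) * (w₂ * x₂) + (w₁ * y₁) * (w₂ * (x₂ - y₂)) := by ring
  have hD := (abs_nonneg _).trans hD₁
  have hM := (abs_nonneg _).trans hx₂
  rw [h]
  refine (abs_add_le _ _).trans ?_
  rw [abs_mul, abs_mul (w₁ * y₁)]
  calc _ ≤ D * M + M * D := by gcongr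
    _ = _ := by ring

lemma weighted_lipschitz_three {wv w₁ w₂ w₃ c κ x₁ x₂ x₃ y₁ y₂ y₃ M D : ℝ} (hwv : 0 ≤ wv)
    (hκ : 0 ≤ κ) (hw₁ : 0 ≤ w₁) (hw₂ : 0 ≤ w₂) (hw₃ : 0 ≤ w₃)
    (hc : wv * |c| ≤ κ * (w₁ * w₂ * w₃))
    (hx₂ : |w₂ * x₂| ≤ M) (hx₃ : |w₃ * x₃| ≤ M) (hy₁ : |w₁ * y₁| ≤ M) (hy₂ : |w₂ * y₂| ≤ M)
    (hD₁ : |w₁ * (x₁ - y₁)| ≤ D) (hD₂ : |w₂ * (x₂ - y₂)| ≤ D) (hD₃ : |w₃ * (x₃ - y₃)| ≤ D) :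
    |wv * (c * (x₁ * x₂ * x₃) - c * (y₁ * y₂ * y₃))| ≤ κ * (3 * M ^ 2 * D) := by
  refine weighted_lipschitz_one hwv (mul_nonneg (mul_nonneg hw₁ hw₂) hw₃) hκ hc ?_
  have h : w₁ * w₂ * w₃ * (x₁ * x₂ * x₃ - y₁ * y₂ * y₃)
      = (w₁ * (x₁ - y₁)) * (w₂ * x₂) * (w₃ * x₃) + (w₁ * y₁) * (w₂ * (x₂ - y₂)) * (w₃ * x₃)
        + (w₁ * y₁) * (w₂ * y₂) * (w₃ * (x₃ - y₃)) := by ring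
  have hD := (abs_nonneg _).trans hD₁
  have hM := (abs_nonneg _).trans hx₂
  rw [h]
  refine (abs_add_three _ _ _).trans ?_
  simp only [abs_mul _ (w₃ * _), abs_mul _ (w₂ * _)]
  calc _ ≤ D * M * M + M * D * M + M * M * D := by gcongr
    _ = _ := by ring

section Lipschitz

variable {β δ ρ W M D : ℝ} (hβ : 0 ≤ β) (hδ : 0 ≤ δ) (hδ1 : δ ≤ 1) (hρ : 0 < ρ) (hW1 : 1 ≤ W)
  (hW : ∀ z, weight β z * gauss z ≤ W)
  {v u p q : V3} (h : ‖p‖ ^ 2 + ‖q‖ ^ 2 = ‖v‖ ^ 2 + ‖u‖ ^ 2) {f g : V3 → ℝ}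
  (hD : ∀ z, |weight β z * (f z - g z)| ≤ D)
include hβ hδ hδ1 hρ hW1 hW h hD

lemma linDensity_sub_le :
    |weight β v * (linDensity δ ρ f v u p q - linDensity δ ρ g v u p q)|
      ≤ 2 * gaussConst ρ ^ 4 * W * gauss u * (3 * D) := by
  have h' : ‖q‖ ^ 2 + ‖p‖ ^ 2 = ‖v‖ ^ 2 + ‖u‖ ^ 2 := by rw [← h]; ring
  have w0 : ∀ z, 0 ≤ weight β z := fun z => zero_le_one.trans (one_le_weight hβ z)
  have hκ : 0 ≤ 2 * gaussConst ρ ^ 4 * W * gauss u := by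
    have := gauss_pos u
    have := gaussConst_one_le hρ
    positivity
  have t1 := weighted_lipschitz_one (w0 v) (w0 q) hκ (lin_gain_coeff hβ hδ hδ1 hρ hW1 hW h) (hD q)
  have t2 := weighted_lipschitz_one (w0 v) (w0 p) hκ (lin_gain_coeff hβ hδ hδ1 hρ hW1 hW h') (hD p)
  have t3 := weighted_lipschitz_one (w0 v) (w0 u) hκ (lin_loss_coeff hβ hδ hδ1 hρ hW1 hW h) (hD u)
  unfold linDensity
  have e : ∀ a1 a2 a3 x1 x2 x3 y1 y2 y3 w κ : ℝ, |w * (a1 * x1 - a1 * y1)| ≤ κ * D →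
      |w * (a2 * x2 - a2 * y2)| ≤ κ * D → |w * (a3 * x3 - a3 * y3)| ≤ κ * D →
      |w * (a1 * x1 + a2 * x2 - a3 * x3 - (a1 * y1 + a2 * y2 - a3 * y3))| ≤ κ * (3 * D) := by
    intro a1 a2 a3 x1 x2 x3 y1 y2 y3 w κ h1 h2 h3
    rw [abs_le] at *
    constructor <;> linarith
  exact e _ _ _ _ _ _ _ _ _ _ _ t1 t2 t3

lemma nonlinDensity_sub_le (hf : ∀ z, |weight β z * f z| ≤ M) (hg : ∀ z, |weight β z * g z| ≤ M) :
    |weight β v * (1 / sqrtMuBar δ ρ v * nonlinDensity δ ρ f v u p q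
        - 1 / sqrtMuBar δ ρ v * nonlinDensity δ ρ g v u p q)|
      ≤ 2 * gaussConst ρ ^ 4 * W * gauss u * (12 * (M + M ^ 2) * D) := by
  have h' : ‖q‖ ^ 2 + ‖p‖ ^ 2 = ‖v‖ ^ 2 + ‖u‖ ^ 2 := by rw [← h]; ring
  have w0 : ∀ z, 0 ≤ weight β z := fun z => zero_le_one.trans (one_le_weight hβ z)
  have hκ : 0 ≤ 2 * gaussConst ρ ^ 4 * W * gauss u := by
    have := gauss_pos u
    have := gaussConst_one_le hρ
    positivity
  have t1 := weighted_lipschitz_two (w0 v) hκ (w0 q) (w0 p)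
    (quad_gain_coeff hβ hδ hδ1 hρ hW1 h) (hf p) (hg q) (hD q) (hD p)
  have t2 := weighted_lipschitz_two (w0 v) hκ (w0 u) (w0 v)
    (quad_loss_coeff (p := p) (q := q) hβ hδ hρ hW1) (hf v) (hg u) (hD u) (hD v)
  have t3 := weighted_lipschitz_two (w0 v) hκ (w0 p) (w0 u)
    (quad_mixed_coeff hβ hδ hδ1 hρ hW1 hW h) (hf u) (hg p) (hD p) (hD u)
  have t4 := weighted_lipschitz_two (w0 v) hκ (w0 q) (w0 u)
    (quad_mixed_coeff hβ hδ hδ1 hρ hW1 hW h') (hf u) (hg q) (hD q) (hD u)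
  have t5 := weighted_lipschitz_two (w0 v) hκ (w0 p) (w0 v)
    (quad_diag_coeff hβ hδ hδ1 hρ hW1 h) (hf v) (hg p) (hD p) (hD v)
  have t6 := weighted_lipschitz_two (w0 v) hκ (w0 q) (w0 v)
    (quad_diag_coeff hβ hδ hδ1 hρ hW1 h') (hf v) (hg q) (hD q) (hD v)
  have t7 := weighted_lipschitz_three (w0 v) hκ (w0 u) (w0 v) (w0 q)
    (cubic_loss_coeff hβ hδ hδ1 hρ hW1) (hf v) (hf q) (hg u) (hg v) (hD u) (hD v) (hD q)
  have t8 := weighted_lipschitz_three (w0 v) hκ (w0 u) (w0 v) (w0 p)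
    (cubic_loss_coeff hβ hδ hδ1 hρ hW1) (hf v) (hf p) (hg u) (hg v) (hD u) (hD v) (hD p)
  have t9 := weighted_lipschitz_three (w0 v) hκ (w0 q) (w0 p) (w0 u)
    (cubic_gain_coeff hβ hδ hδ1 hρ hW1 h) (hf p) (hf u) (hg q) (hg p) (hD q) (hD p) (hD u)
  have t10 := weighted_lipschitz_three (w0 v) hκ (w0 q) (w0 p) (w0 v)
    (cubic_diag_coeff hβ hδ hδ1 hρ hW1 h) (hf p) (hf v) (hg q) (hg p) (hD q) (hD p) (hD v)
  have e : ∀ φ : V3 → ℝ, 1 / sqrtMuBar δ ρ v * nonlinDensity δ ρ φ v u p q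
      = 1 / sqrtMuBar δ ρ v * (sqrtMuBar δ ρ q * sqrtMuBar δ ρ p
          * (1 - δ * mu δ ρ v - δ * mu δ ρ u)) * (φ q * φ p)
        - 1 / sqrtMuBar δ ρ v * (sqrtMuBar δ ρ u * sqrtMuBar δ ρ v
          * (1 - δ * mu δ ρ p - δ * mu δ ρ q)) * (φ u * φ v)
        + 1 / sqrtMuBar δ ρ v * (sqrtMuBar δ ρ p * sqrtMuBar δ ρ u
          * (δ * (mu δ ρ v - mu δ ρ q))) * (φ p * φ u)
        + 1 / sqrtMuBar δ ρ v * (sqrtMuBar δ ρ q * sqrtMuBar δ ρ u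
          * (δ * (mu δ ρ v - mu δ ρ p))) * (φ q * φ u)
        + 1 / sqrtMuBar δ ρ v * (sqrtMuBar δ ρ p * sqrtMuBar δ ρ v
          * (δ * (mu δ ρ u - mu δ ρ q))) * (φ p * φ v)
        + 1 / sqrtMuBar δ ρ v * (sqrtMuBar δ ρ q * sqrtMuBar δ ρ v
          * (δ * (mu δ ρ u - mu δ ρ p))) * (φ q * φ v)
        + 1 / sqrtMuBar δ ρ v * (δ * sqrtMuBar δ ρ u * sqrtMuBar δ ρ v * sqrtMuBar δ ρ q)
          * (φ u * φ v * φ q)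
        + 1 / sqrtMuBar δ ρ v * (δ * sqrtMuBar δ ρ u * sqrtMuBar δ ρ v * sqrtMuBar δ ρ p)
          * (φ u * φ v * φ p)
        - 1 / sqrtMuBar δ ρ v * (δ * sqrtMuBar δ ρ q * sqrtMuBar δ ρ p * sqrtMuBar δ ρ u)
          * (φ q * φ p * φ u)
        - 1 / sqrtMuBar δ ρ v * (δ * sqrtMuBar δ ρ q * sqrtMuBar δ ρ p * sqrtMuBar δ ρ v)
          * (φ q * φ p * φ v) := by
    intro φ
    unfold nonlinDensity
    ring
  have E : ∀ w κ x1 x2 x3 x4 x5 x6 x7 x8 x9 x10 y1 y2 y3 y4 y5 y6 y7 y8 y9 y10 : ℝ,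
      |w * (x1 - y1)| ≤ κ * (2 * M * D) → |w * (x2 - y2)| ≤ κ * (2 * M * D) →
      |w * (x3 - y3)| ≤ κ * (2 * M * D) → |w * (x4 - y4)| ≤ κ * (2 * M * D) →
      |w * (x5 - y5)| ≤ κ * (2 * M * D) → |w * (x6 - y6)| ≤ κ * (2 * M * D) →
      |w * (x7 - y7)| ≤ κ * (3 * M ^ 2 * D) → |w * (x8 - y8)| ≤ κ * (3 * M ^ 2 * D) →
      |w * (x9 - y9)| ≤ κ * (3 * M ^ 2 * D) → |w * (x10 - y10)| ≤ κ * (3 * M ^ 2 * D) →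
      |w * (x1 - x2 + x3 + x4 + x5 + x6 + x7 + x8 - x9 - x10
        - (y1 - y2 + y3 + y4 + y5 + y6 + y7 + y8 - y9 - y10))| ≤ κ * (12 * (M + M ^ 2) * D) := by
    intro w κ x1 x2 x3 x4 x5 x6 x7 x8 x9 x10 y1 y2 y3 y4 y5 y6 y7 y8 y9 y10
      h1 h2 h3 h4 h5 h6 h7 h8 h9 h10
    rw [abs_le] at *
    constructor <;> linarith
  rw [e f, e g]
  exact E _ _ _ _ _ _ _ _ _ _ _ _ _ _ _ _ _ _ _ _ _ _ t1 t2 t3 t4 t5 t6 t7 t8 t9 t10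

end Lipschitz

/-- The collision bracket of the full equation,
`F(u')F(v')(1 - δF(u))(1 - δF(v)) - F(u)F(v)(1 - δF(u'))(1 - δF(v'))`. -/
noncomputable def collisionBracket (δ : ℝ) (F : V3 → ℝ) (v u p q : V3) : ℝ :=
  F q * F p * (1 - δ * F u) * (1 - δ * F v) - F u * F v * (1 - δ * F q) * (1 - δ * F p)

/-- The integrand of `ν_δ(v)` without the kernel `B`. -/
noncomputable def freqDensity (δ ρ : ℝ) (u p q : V3) : ℝ :=
  let m := mu δ ρ
  m u - δ * m u * m q - δ * m u * m p + δ * m q * m p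

/-- The operators `-ν_δ + K_δ` and `Γ_δ` are the expansion of the collision operator around the
equilibrium, already at the level of integrands. -/
lemma collisionBracket_expand {δ ρ : ℝ} (hδ : 0 ≤ δ) (hρ : 0 < ρ) {v u p q : V3}
    (h : ‖p‖ ^ 2 + ‖q‖ ^ 2 = ‖v‖ ^ 2 + ‖u‖ ^ 2) (f : V3 → ℝ) :
    linDensity δ ρ f v u p q + 1 / sqrtMuBar δ ρ v * nonlinDensity δ ρ f v u p q
        - freqDensity δ ρ u p q * f v
      = 1 / sqrtMuBar δ ρ v * collisionBracket δ (fun z => distribution δ ρ z (f z)) v u p q := by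
  have hr := sqrtMuBar_pos hδ hρ v
  have hb := detailed_balance hδ hρ h
  unfold linDensity nonlinDensity freqDensity collisionBracket distribution
  field_simp
  linear_combination -hb

lemma freqDensity_nonneg {δ ρ : ℝ} (hδ : 0 ≤ δ) (hρ : 0 < ρ) (u p q : V3) :
    0 ≤ freqDensity δ ρ u p q := by
  unfold freqDensity
  have hu := mu_pos hδ hρ u; have hp := mu_pos hδ hρ p; have hq := mu_pos hδ hρ q
  have hu1 := delta_mul_mu_lt_one hδ hρ u
  have hp1 := delta_mul_mu_lt_one hδ hρ p
  have hq1 := delta_mul_mu_lt_one hδ hρ q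
  have e : mu δ ρ u - δ * mu δ ρ u * mu δ ρ q - δ * mu δ ρ u * mu δ ρ p + δ * mu δ ρ q * mu δ ρ p
      = mu δ ρ u * (1 - δ * mu δ ρ q) * (1 - δ * mu δ ρ p)
        + δ * (mu δ ρ q * mu δ ρ p * (1 - δ * mu δ ρ u)) := by ring
  simp only [e]
  have := sub_pos.2 hu1; have := sub_pos.2 hp1; have := sub_pos.2 hq1
  positivity

lemma freqDensity_le {δ ρ : ℝ} (hδ : 0 ≤ δ) (hδ1 : δ ≤ 1) (hρ : 0 < ρ) {v u p q : V3}
    (h : ‖p‖ ^ 2 + ‖q‖ ^ 2 = ‖v‖ ^ 2 + ‖u‖ ^ 2) :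
    freqDensity δ ρ u p q ≤ 2 * gaussConst ρ ^ 2 * gauss u := by
  unfold freqDensity
  have hS := gaussConst_one_le hρ
  have hg := gauss_mul_gauss h
  have Xv := gauss_pos v; have Xu := gauss_pos u; have Xp := gauss_pos p; have Xq := gauss_pos q
  have Xu1 := gauss_le_one u; have Xv1 := gauss_le_one v
  have hu := mu_pos hδ hρ u; have hp := mu_pos hδ hρ p; have hq := mu_pos hδ hρ q
  have h1 : δ * (mu δ ρ q * mu δ ρ p) ≤ gaussConst ρ ^ 2 * gauss u := by
    calc _ ≤ 1 * ((gaussConst ρ * gauss q ^ 2) * (gaussConst ρ * gauss p ^ 2)) := by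
          gcongr
          · exact mu_le hδ hρ q
          · exact mu_le hδ hρ p
      _ = gaussConst ρ ^ 2 * (gauss p * gauss q) ^ 2 := by ring
      _ = gaussConst ρ ^ 2 * ((gauss u * gauss v ^ 2) * gauss u) := by rw [hg]; ring
      _ ≤ gaussConst ρ ^ 2 * ((1 * 1 ^ 2) * gauss u) := by gcongr
      _ = _ := by ring
  have h2 : mu δ ρ u ≤ gaussConst ρ ^ 2 * gauss u := by
    calc _ ≤ gaussConst ρ * gauss u ^ 2 := mu_le hδ hρ u
      _ ≤ gaussConst ρ ^ 2 * gauss u ^ 1 := by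
        gcongr ?_ * ?_
        · exact le_self_pow₀ hS (by norm_num)
        · exact pow_le_pow_of_le_one Xu.le Xu1 (by norm_num)
      _ = _ := by ring
  have h3 : 0 ≤ δ * mu δ ρ u * mu δ ρ q := by positivity
  have h4 : 0 ≤ δ * mu δ ρ u * mu δ ρ p := by positivity
  simp only
  linarith

/-! ### Integrability of the collision kernel -/

instance : IsFiniteMeasure sphereMeasure := by unfold sphereMeasure; infer_instance

lemma norm_sq_post (v u : V3) (ω : S2) :
    ‖postV v u ω‖ ^ 2 + ‖postU v u ω‖ ^ 2 = ‖v‖ ^ 2 + ‖u‖ ^ 2 := by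
  have hω : ‖(ω : V3)‖ = 1 := norm_eq_of_mem_sphere ω
  unfold postV postU
  rw [norm_sub_sq_real, norm_add_sq_real, norm_smul, inner_smul_right, inner_smul_right, hω,
    inner_sub_left, Real.norm_eq_abs, mul_one, sq_abs]
  ring

lemma measurable_gauss : Measurable gauss := by unfold gauss; fun_prop

lemma measurable_mu (δ ρ : ℝ) : Measurable (mu δ ρ) := by unfold mu; fun_prop

lemma measurable_sqrtMuBar (δ ρ : ℝ) : Measurable (sqrtMuBar δ ρ) := by
  have := measurable_mu δ ρ
  unfold sqrtMuBar; fun_prop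

lemma integrable_gauss : Integrable gauss (volume : Measure V3) := by
  have h := GaussianFourier.integrable_cexp_neg_mul_sq_norm_add (V := V3) (b := (1 / 4 : ℂ))
    (by norm_num) 0 0
  have h2 := h.norm
  refine h2.congr (Filter.Eventually.of_forall fun v => ?_)
  simp only [Complex.norm_exp, gauss]
  congr 1
  simp [← Complex.ofReal_pow]
  ring

lemma integrable_norm_rpow_ball {γ : ℝ} (hγ : -3 < γ) :
    IntegrableOn (fun z : V3 => ‖z‖ ^ γ) (Metric.ball 0 1) := by
  rw [integrableOn_fun_norm_addHaar (μ := (volume : Measure V3)) (f := fun y => y ^ γ)]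
  have h1 : IntegrableOn (fun y : ℝ => y ^ (2 + γ)) (Ioo 0 1) :=
    ((intervalIntegrable_iff_integrableOn_Ioc_of_le zero_le_one).1
      (intervalIntegral.intervalIntegrable_rpow' (by linarith))).mono_set Ioo_subset_Ioc_self
  refine h1.congr_fun (fun y hy => ?_) measurableSet_Ioo
  simp only [finrank_euclideanSpace, Fintype.card_fin, smul_eq_mul]
  rw [Real.rpow_add hy.1]
  norm_num

/-- The collision kernel against a Gaussian is integrable in `u`, uniformly in `v`: near `u = v`
the singularity `|v - u|^γ` is integrable as `γ > -3`, and elsewhere the Gaussian dominates. -/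
lemma exists_integral_rpow_gauss_le {γ : ℝ} (hγ : -3 < γ) (hγ0 : γ < 0) :
    ∃ J : ℝ, 0 ≤ J ∧ ∀ v : V3, Integrable (fun u : V3 => ‖v - u‖ ^ γ * gauss u) ∧
      ∫ u : V3, ‖v - u‖ ^ γ * gauss u ≤ J := by
  set h : V3 → ℝ := (Metric.ball (0 : V3) 1).indicator fun z => ‖z‖ ^ γ with hh
  have hint : Integrable h := (integrable_norm_rpow_ball hγ).integrable_indicator measurableSet_ball
  have h0 : ∀ z, 0 ≤ h z := fun z => indicator_nonneg (fun z _ => by positivity) z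
  have hle : ∀ v u : V3, ‖v - u‖ ^ γ * gauss u ≤ h (v - u) + gauss u := by
    intro v u
    by_cases hz : v - u ∈ Metric.ball (0 : V3) 1
    · have : h (v - u) = ‖v - u‖ ^ γ := indicator_of_mem hz _
      rw [this]
      have h1 : (0 : ℝ) ≤ ‖v - u‖ ^ γ := by positivity
      nlinarith [gauss_pos u, gauss_le_one u]
    · have h1 : 1 ≤ ‖v - u‖ := by simpa using hz
      have h2 : ‖v - u‖ ^ γ ≤ 1 := Real.rpow_le_one_of_one_le_of_nonpos h1 hγ0.le
      nlinarith [h0 (v - u), gauss_pos u]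
  have hmaj : ∀ v : V3, Integrable fun u => h (v - u) + gauss u := fun v =>
    (hint.comp_sub_left v).add integrable_gauss
  have hI : ∀ v : V3, Integrable (fun u : V3 => ‖v - u‖ ^ γ * gauss u) := by
    intro v
    refine (hmaj v).mono' ?_ (Filter.Eventually.of_forall fun u => ?_)
    · have := measurable_gauss
      exact Measurable.aestronglyMeasurable (by fun_prop)
    · rw [Real.norm_of_nonneg (mul_nonneg (by positivity) (gauss_pos u).le)]
      exact hle v u
  refine ⟨(∫ z, h z) + ∫ z, gauss z, ?_, fun v => ⟨hI v, ?_⟩⟩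
  · exact add_nonneg (integral_nonneg h0) (integral_nonneg fun z => (gauss_pos z).le)
  · calc _ ≤ ∫ u, (h (v - u) + gauss u) := integral_mono (hI v) (hmaj v) (hle v)
      _ = (∫ u, h (v - u)) + ∫ u, gauss u := integral_add (hint.comp_sub_left v) integrable_gauss
      _ = _ := by rw [integral_sub_left_eq_self h volume v]

lemma measurable_kernelB {α : Type*} [MeasurableSpace α] {γ : ℝ} {b : ℝ → ℝ} (hb : Measurable b)
    {v u : α → V3} {ω : α → S2} (hv : Measurable v) (hu : Measurable u) (hω : Measurable ω) :
    Measurable fun a => kernelB γ b (v a) (u a) (ω a) := by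
  unfold kernelB InnerProductGeometry.angle
  refine Measurable.mul (by fun_prop) (hb.comp ?_)
  exact Real.continuous_arccos.measurable.comp (by fun_prop)

lemma measurable_postV {α : Type*} [MeasurableSpace α]
    {v u : α → V3} {ω : α → S2} (hv : Measurable v) (hu : Measurable u) (hω : Measurable ω) :
    Measurable fun a => postV (v a) (u a) (ω a) := by
  unfold postV
  fun_prop

lemma measurable_postU {α : Type*} [MeasurableSpace α]
    {v u : α → V3} {ω : α → S2} (hv : Measurable v) (hu : Measurable u) (hω : Measurable ω) :
    Measurable fun a => postU (v a) (u a) (ω a) := by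
  unfold postU
  fun_prop

/-- The angular bound `0 ≤ b(θ) ≤ C_b |cos θ|` on `[0, π]`. -/
def AngularBound (Cb : ℝ) (b : ℝ → ℝ) : Prop :=
  ∀ θ ∈ Set.Icc (0 : ℝ) Real.pi, 0 ≤ b θ ∧ b θ ≤ Cb * |Real.cos θ|

section Kernel

variable {γ Cb : ℝ} {b : ℝ → ℝ}

lemma kernelB_nonneg (hbd : AngularBound Cb b) (v u : V3) (ω : S2) : 0 ≤ kernelB γ b v u ω := by
  have := (hbd _ ⟨InnerProductGeometry.angle_nonneg (v - u) ω,
    InnerProductGeometry.angle_le_pi (v - u) ω⟩).1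
  unfold kernelB
  positivity

lemma kernelB_le (hbd : AngularBound Cb b) (v u : V3) (ω : S2) :
    kernelB γ b v u ω ≤ |Cb| * ‖v - u‖ ^ γ := by
  have h := (hbd _ ⟨InnerProductGeometry.angle_nonneg (v - u) ω,
    InnerProductGeometry.angle_le_pi (v - u) ω⟩).2
  have h1 : b (InnerProductGeometry.angle (v - u) ω) ≤ |Cb| := by
    refine h.trans ((le_abs_self _).trans ?_)
    rw [abs_mul, abs_abs]
    exact mul_le_of_le_one_right (abs_nonneg _) (Real.abs_cos_le_one _)
  unfold kernelB
  rw [mul_comm]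
  gcongr

/-- The product measure `du dω` of the collision integrals. -/
noncomputable abbrev collisionMeasure : Measure (V3 × S2) :=
  (volume : Measure V3).prod sphereMeasure

/-- A bound `J` for `∫∫ |v - u|^γ e^{-|u|²/4} du dω`, uniform in `v`. -/
def KernelBound (γ J : ℝ) : Prop :=
  0 ≤ J ∧ ∀ v : V3, Integrable (fun x : V3 × S2 => ‖v - x.1‖ ^ γ * gauss x.1) collisionMeasure ∧
    ∫ x, ‖v - x.1‖ ^ γ * gauss x.1 ∂collisionMeasure ≤ J

lemma exists_kernelBound (hγ : -3 < γ) (hγ0 : γ < 0) : ∃ J, KernelBound γ J := by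
  obtain ⟨J, hJ, h⟩ := exists_integral_rpow_gauss_le hγ hγ0
  refine ⟨sphereMeasure.real univ * J, by positivity, fun v => ⟨?_, ?_⟩⟩
  · exact (h v).1.comp_fst sphereMeasure
  · rw [integral_fun_fst (fun u : V3 => ‖v - u‖ ^ γ * gauss u), smul_eq_mul]
    exact mul_le_mul_of_nonneg_left (h v).2 measureReal_nonneg

variable {J c : ℝ} (hb : Measurable b) (hbd : AngularBound Cb b) (hJ : KernelBound γ J)
  {v : V3} {d : V3 × S2 → ℝ} (hd : Measurable d) (hdc : ∀ x, |d x| ≤ c * gauss x.1)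
include hbd

lemma abs_kernelB_mul_le (hdc : ∀ x, |d x| ≤ c * gauss x.1) (x : V3 × S2) :
    |kernelB γ b v x.1 x.2 * d x| ≤ c * |Cb| * (‖v - x.1‖ ^ γ * gauss x.1) := by
  rw [abs_mul, abs_of_nonneg (kernelB_nonneg hbd v x.1 x.2)]
  calc _ ≤ (|Cb| * ‖v - x.1‖ ^ γ) * (c * gauss x.1) := by
        gcongr
        · exact kernelB_le hbd v x.1 x.2
        · exact hdc x
    _ = _ := by ring

include hb hJ hd hdc

lemma integrable_kernelB_mul :
    Integrable (fun x : V3 × S2 => kernelB γ b v x.1 x.2 * d x) collisionMeasure := by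
  refine ((hJ.2 v).1.const_mul (c * |Cb|)).mono' ?_ (Filter.Eventually.of_forall
    fun x => abs_kernelB_mul_le hbd hdc x)
  have h1 : Measurable fun x : V3 × S2 => kernelB γ b v x.1 x.2 :=
    measurable_kernelB hb measurable_const measurable_fst measurable_snd
  exact (h1.mul hd).aestronglyMeasurable

lemma integral_kernelB_mul_eq :
    ∫ u : V3, ∫ ω : S2, kernelB γ b v u ω * d (u, ω) ∂sphereMeasure
      = ∫ x, kernelB γ b v x.1 x.2 * d x ∂collisionMeasure :=
  (integral_prod _ (integrable_kernelB_mul hb hbd hJ hd hdc)).symm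

omit hb hd in
lemma abs_integral_kernelB_mul_le (hc : 0 ≤ c) :
    |∫ x, kernelB γ b v x.1 x.2 * d x ∂collisionMeasure| ≤ c * |Cb| * J := by
  have h1 : |∫ x, kernelB γ b v x.1 x.2 * d x ∂collisionMeasure|
      ≤ ∫ x, c * |Cb| * (‖v - x.1‖ ^ γ * gauss x.1) ∂collisionMeasure :=
    norm_integral_le_of_norm_le (f := fun x : V3 × S2 => kernelB γ b v x.1 x.2 * d x)
      ((hJ.2 v).1.const_mul (c * |Cb|))
      (Filter.Eventually.of_forall fun x => abs_kernelB_mul_le hbd hdc x)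
  rw [integral_const_mul] at h1
  exact h1.trans (mul_le_mul_of_nonneg_left (hJ.2 v).2 (by positivity))

end Kernel

/-! ### Weighted Lipschitz bounds for the collision operators -/

lemma measurable_linDensity {α : Type*} [MeasurableSpace α] (δ ρ : ℝ) {f : α → V3 → ℝ}
    (hf : Measurable (Function.uncurry f)) {v u p q : α → V3} (hv : Measurable v)
    (hu : Measurable u) (hp : Measurable p) (hq : Measurable q) :
    Measurable fun a => linDensity δ ρ (f a) (v a) (u a) (p a) (q a) := by
  have hm := measurable_mu δ ρ
  have hr := measurable_sqrtMuBar δ ρ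
  have hfp : Measurable fun a => f a (p a) := hf.comp (measurable_id.prodMk hp)
  have hfq : Measurable fun a => f a (q a) := hf.comp (measurable_id.prodMk hq)
  have hfu : Measurable fun a => f a (u a) := hf.comp (measurable_id.prodMk hu)
  unfold linDensity
  fun_prop

lemma measurable_nonlinDensity {α : Type*} [MeasurableSpace α] (δ ρ : ℝ) {f : α → V3 → ℝ}
    (hf : Measurable (Function.uncurry f)) {v u p q : α → V3} (hv : Measurable v)
    (hu : Measurable u) (hp : Measurable p) (hq : Measurable q) :
    Measurable fun a => nonlinDensity δ ρ (f a) (v a) (u a) (p a) (q a) := by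
  have hm := measurable_mu δ ρ
  have hr := measurable_sqrtMuBar δ ρ
  have hfp : Measurable fun a => f a (p a) := hf.comp (measurable_id.prodMk hp)
  have hfq : Measurable fun a => f a (q a) := hf.comp (measurable_id.prodMk hq)
  have hfu : Measurable fun a => f a (u a) := hf.comp (measurable_id.prodMk hu)
  have hfv : Measurable fun a => f a (v a) := hf.comp (measurable_id.prodMk hv)
  simp only [nonlinDensity]
  fun_prop

lemma measurable_freqDensity {α : Type*} [MeasurableSpace α] (δ ρ : ℝ) {u p q : α → V3}
    (hu : Measurable u) (hp : Measurable p) (hq : Measurable q) :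
    Measurable fun a => freqDensity δ ρ (u a) (p a) (q a) := by
  have hm := measurable_mu δ ρ
  unfold freqDensity
  fun_prop

lemma measurable_post (v : V3) :
    Measurable (fun x : V3 × S2 => postV v x.1 x.2) ∧
      Measurable (fun x : V3 × S2 => postU v x.1 x.2) :=
  ⟨measurable_postV measurable_const measurable_fst measurable_snd,
    measurable_postU measurable_const measurable_fst measurable_snd⟩

/-- Assumptions on the parameters that stay fixed in the estimates: the kernel `B`, a bound `J` for
its integrals against Gaussians, and a bound `W` for the weight against Gaussians. -/
structure Admissible (γ Cb J β W δ ρ : ℝ) (b : ℝ → ℝ) : Prop where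
  measurable_b : Measurable b
  angular : AngularBound Cb b
  kernel : KernelBound γ J
  one_le_W : 1 ≤ W
  weight_gauss : ∀ z, weight β z * gauss z ≤ W
  beta_nonneg : 0 ≤ β
  delta_nonneg : 0 ≤ δ
  delta_le_one : δ ≤ 1
  rho_pos : 0 < ρ

/-- The constant in the weighted Lipschitz bounds. -/
noncomputable def lipConst (Cb J W ρ : ℝ) : ℝ := 2 * gaussConst ρ ^ 4 * W * |Cb| * J

lemma linDensity_zero (δ ρ : ℝ) (v u p q : V3) : linDensity δ ρ 0 v u p q = 0 := by
  simp [linDensity]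

lemma nonlinDensity_zero (δ ρ : ℝ) (v u p q : V3) : nonlinDensity δ ρ 0 v u p q = 0 := by
  simp [nonlinDensity]

section Operators

variable {γ Cb J β W δ ρ : ℝ} {b : ℝ → ℝ} (A : Admissible γ Cb J β W δ ρ b)
include A

lemma lipConst_nonneg : 0 ≤ lipConst Cb J W ρ := by
  have := gaussConst_one_le A.rho_pos
  have := A.one_le_W
  have := A.kernel.1
  unfold lipConst
  positivity

variable {f : V3 → ℝ} {M : ℝ} (hf : Measurable f) (hfM : ∀ z, |weight β z * f z| ≤ M)

lemma linDensity_abs_le (hfM : ∀ z, |weight β z * f z| ≤ M) {v u p q : V3}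
    (h : ‖p‖ ^ 2 + ‖q‖ ^ 2 = ‖v‖ ^ 2 + ‖u‖ ^ 2) :
    |linDensity δ ρ f v u p q| ≤ 2 * gaussConst ρ ^ 4 * W * (3 * M) * gauss u := by
  have h1 := linDensity_sub_le (g := 0) (D := M) A.beta_nonneg A.delta_nonneg A.delta_le_one A.rho_pos
    A.one_le_W A.weight_gauss h (by simpa using hfM)
  rw [linDensity_zero, sub_zero, abs_mul] at h1
  have hw := one_le_weight A.beta_nonneg v
  rw [abs_of_nonneg (zero_le_one.trans hw)] at h1
  nlinarith [abs_nonneg (linDensity δ ρ f v u p q)]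

lemma nonlinDensity_abs_le (hfM : ∀ z, |weight β z * f z| ≤ M) {v u p q : V3}
    (h : ‖p‖ ^ 2 + ‖q‖ ^ 2 = ‖v‖ ^ 2 + ‖u‖ ^ 2) :
    |1 / sqrtMuBar δ ρ v * nonlinDensity δ ρ f v u p q|
      ≤ 2 * gaussConst ρ ^ 4 * W * (12 * (M + M ^ 2) * M) * gauss u := by
  have hM := (abs_nonneg _).trans (hfM 0)
  have h1 := nonlinDensity_sub_le (g := 0) (D := M) A.beta_nonneg A.delta_nonneg A.delta_le_one
    A.rho_pos A.one_le_W A.weight_gauss h (by simpa using hfM) hfM (by simpa using hM)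
  rw [nonlinDensity_zero, mul_zero, sub_zero, abs_mul] at h1
  have hw := one_le_weight A.beta_nonneg v
  rw [abs_of_nonneg (zero_le_one.trans hw)] at h1
  nlinarith [abs_nonneg (1 / sqrtMuBar δ ρ v * nonlinDensity δ ρ f v u p q)]

lemma abs_freqDensity_le {v u p q : V3} (h : ‖p‖ ^ 2 + ‖q‖ ^ 2 = ‖v‖ ^ 2 + ‖u‖ ^ 2) :
    |freqDensity δ ρ u p q| ≤ 2 * gaussConst ρ ^ 2 * gauss u := by
  rw [abs_of_nonneg (freqDensity_nonneg A.delta_nonneg A.rho_pos u p q)]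
  exact freqDensity_le A.delta_nonneg A.delta_le_one A.rho_pos h

include hf hfM

omit A hfM in
lemma measurable_linDensity_post (v : V3) : Measurable fun x : V3 × S2 =>
    linDensity δ ρ f v x.1 (postV v x.1 x.2) (postU v x.1 x.2) :=
  measurable_linDensity δ ρ (f := fun _ => f) (hf.comp measurable_snd) measurable_const
    measurable_fst (measurable_post v).1 (measurable_post v).2

omit A hfM in
lemma measurable_nonlinDensity_post (v : V3) : Measurable fun x : V3 × S2 =>
    1 / sqrtMuBar δ ρ v * nonlinDensity δ ρ f v x.1 (postV v x.1 x.2) (postU v x.1 x.2) :=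
  (measurable_nonlinDensity δ ρ (f := fun _ => f) (hf.comp measurable_snd) measurable_const
    measurable_fst (measurable_post v).1 (measurable_post v).2).const_mul _

lemma integrable_linDensity (v : V3) : Integrable (fun x : V3 × S2 => kernelB γ b v x.1 x.2 *
    linDensity δ ρ f v x.1 (postV v x.1 x.2) (postU v x.1 x.2)) collisionMeasure :=
  integrable_kernelB_mul A.measurable_b A.angular A.kernel (measurable_linDensity_post hf v)
    fun x => linDensity_abs_le A hfM (norm_sq_post v x.1 x.2)

lemma integrable_nonlinDensity (v : V3) : Integrable (fun x : V3 × S2 => kernelB γ b v x.1 x.2 *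
    (1 / sqrtMuBar δ ρ v * nonlinDensity δ ρ f v x.1 (postV v x.1 x.2) (postU v x.1 x.2)))
    collisionMeasure :=
  integrable_kernelB_mul A.measurable_b A.angular A.kernel (measurable_nonlinDensity_post hf v)
    fun x => nonlinDensity_abs_le A hfM (norm_sq_post v x.1 x.2)

lemma opK_eq (v : V3) : opK γ b δ ρ f v = ∫ x, kernelB γ b v x.1 x.2 *
    linDensity δ ρ f v x.1 (postV v x.1 x.2) (postU v x.1 x.2) ∂collisionMeasure :=
  integral_kernelB_mul_eq A.measurable_b A.angular A.kernel (measurable_linDensity_post hf v)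
    fun x => linDensity_abs_le A hfM (norm_sq_post v x.1 x.2)

lemma opGamma_eq (v : V3) : opGamma γ b δ ρ f v = ∫ x, kernelB γ b v x.1 x.2 *
    (1 / sqrtMuBar δ ρ v * nonlinDensity δ ρ f v x.1 (postV v x.1 x.2) (postU v x.1 x.2))
    ∂collisionMeasure := by
  rw [← integral_kernelB_mul_eq A.measurable_b A.angular A.kernel
    (measurable_nonlinDensity_post hf v)
    fun x => nonlinDensity_abs_le A hfM (norm_sq_post v x.1 x.2)]
  have e : opGamma γ b δ ρ f v = 1 / sqrtMuBar δ ρ v * ∫ u : V3, ∫ ω : S2, kernelB γ b v u ω *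
      nonlinDensity δ ρ f v u (postV v u ω) (postU v u ω) ∂sphereMeasure := rfl
  rw [e, ← integral_const_mul]
  refine integral_congr_ae (Filter.Eventually.of_forall fun u => ?_)
  simp only
  rw [← integral_const_mul]
  refine integral_congr_ae (Filter.Eventually.of_forall fun ω => ?_)
  simp only
  ring

omit hf hfM in
lemma integrable_freqDensity (v : V3) : Integrable (fun x : V3 × S2 => kernelB γ b v x.1 x.2 *
    freqDensity δ ρ x.1 (postV v x.1 x.2) (postU v x.1 x.2)) collisionMeasure :=
  integrable_kernelB_mul A.measurable_b A.angular A.kernel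
    (measurable_freqDensity δ ρ measurable_fst (measurable_post v).1 (measurable_post v).2)
    fun x => abs_freqDensity_le A (norm_sq_post v x.1 x.2)

omit hf hfM in
lemma nu_eq (v : V3) : nu γ b δ ρ v = ∫ x, kernelB γ b v x.1 x.2 *
    freqDensity δ ρ x.1 (postV v x.1 x.2) (postU v x.1 x.2) ∂collisionMeasure :=
  integral_kernelB_mul_eq A.measurable_b A.angular A.kernel
    (measurable_freqDensity δ ρ measurable_fst (measurable_post v).1 (measurable_post v).2)
    fun x => abs_freqDensity_le A (norm_sq_post v x.1 x.2)

omit hf hfM in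
lemma nu_nonneg (v : V3) : 0 ≤ nu γ b δ ρ v := by
  rw [nu_eq A]
  exact integral_nonneg fun x => mul_nonneg (kernelB_nonneg A.angular v x.1 x.2)
    (freqDensity_nonneg A.delta_nonneg A.rho_pos _ _ _)

/-- The collision operator applied to `F = μ + √μ̄ f`. -/
lemma opK_add_opGamma_sub_nu (v : V3) :
    opK γ b δ ρ f v + opGamma γ b δ ρ f v - nu γ b δ ρ v * f v
      = ∫ x, kernelB γ b v x.1 x.2 * (1 / sqrtMuBar δ ρ v * collisionBracket δ
          (fun z => distribution δ ρ z (f z)) v x.1 (postV v x.1 x.2) (postU v x.1 x.2))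
          ∂collisionMeasure := by
  have h1 := integrable_linDensity A hf hfM v
  have h2 := integrable_nonlinDensity A hf hfM v
  have h3 := (integrable_freqDensity A v).mul_const (f v)
  rw [opK_eq A hf hfM, opGamma_eq A hf hfM, nu_eq A, ← integral_mul_const, ← integral_add h1 h2,
    ← integral_sub (f := fun x => _ + _) (h1.add h2) h3]
  refine integral_congr_ae (Filter.Eventually.of_forall fun x => ?_)
  simp only
  rw [← collisionBracket_expand A.delta_nonneg A.rho_pos (norm_sq_post v x.1 x.2)]
  ring

/-- Where `F` vanishes, only the gain term is left. -/
lemma source_ge_of_distribution_eq_zero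
    (hF : ∀ z, 0 ≤ distribution δ ρ z (f z) ∧ δ * distribution δ ρ z (f z) ≤ 1) {v : V3}
    (hv : distribution δ ρ v (f v) = 0) :
    nu γ b δ ρ v * f v ≤ opK γ b δ ρ f v + opGamma γ b δ ρ f v := by
  rw [← sub_nonneg, opK_add_opGamma_sub_nu A hf hfM]
  refine integral_nonneg fun x => mul_nonneg (kernelB_nonneg A.angular v x.1 x.2)
    (mul_nonneg (one_div_nonneg.2 (sqrtMuBar_pos A.delta_nonneg A.rho_pos v).le) ?_)
  simp only [collisionBracket, hv, mul_zero, sub_zero, mul_one, zero_mul]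
  exact mul_nonneg (mul_nonneg (hF _).1 (hF _).1) (sub_nonneg.2 (hF _).2)

/-- Where `δ F = 1`, only the loss term is left. -/
lemma source_le_of_distribution_eq_one
    (hF : ∀ z, 0 ≤ distribution δ ρ z (f z) ∧ δ * distribution δ ρ z (f z) ≤ 1) {v : V3}
    (hv : δ * distribution δ ρ v (f v) = 1) :
    opK γ b δ ρ f v + opGamma γ b δ ρ f v ≤ nu γ b δ ρ v * f v := by
  rw [← sub_nonpos, opK_add_opGamma_sub_nu A hf hfM]
  refine integral_nonpos fun x => mul_nonpos_of_nonneg_of_nonpos (kernelB_nonneg A.angular v x.1 x.2)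
    (mul_nonpos_of_nonneg_of_nonpos
      (one_div_nonneg.2 (sqrtMuBar_pos A.delta_nonneg A.rho_pos v).le) ?_)
  simp only [collisionBracket, hv, sub_self, mul_zero, zero_sub, Left.neg_nonpos_iff]
  exact mul_nonneg (mul_nonneg (mul_nonneg (hF _).1 (hF _).1) (sub_nonneg.2 (hF _).2))
    (sub_nonneg.2 (hF _).2)

variable {g : V3 → ℝ} (hg : Measurable g) (hgM : ∀ z, |weight β z * g z| ≤ M)
  {D : ℝ} (hD : ∀ z, |weight β z * (f z - g z)| ≤ D)
include hg hgM hD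

lemma opK_sub_le (v : V3) :
    |weight β v * (opK γ b δ ρ f v - opK γ b δ ρ g v)| ≤ lipConst Cb J W ρ * (3 * D) := by
  have hD0 := (abs_nonneg _).trans (hD 0)
  have hS := gaussConst_one_le A.rho_pos
  have hW := A.one_le_W
  rw [opK_eq A hf hfM, opK_eq A hg hgM, ← integral_sub (integrable_linDensity A hf hfM v)
    (integrable_linDensity A hg hgM v), ← integral_const_mul]
  have h := abs_integral_kernelB_mul_le (v := v) A.angular A.kernel
    (c := 2 * gaussConst ρ ^ 4 * W * (3 * D))
    (d := fun x => weight β v * (linDensity δ ρ f v x.1 (postV v x.1 x.2) (postU v x.1 x.2)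
      - linDensity δ ρ g v x.1 (postV v x.1 x.2) (postU v x.1 x.2)))
    (fun x => (linDensity_sub_le A.beta_nonneg A.delta_nonneg A.delta_le_one A.rho_pos A.one_le_W
      A.weight_gauss (norm_sq_post v x.1 x.2) hD).trans_eq (by ring)) (by positivity)
  refine le_trans (le_of_eq ?_) (h.trans_eq ?_)
  · congr 2
    funext x
    ring
  · unfold lipConst
    ring

lemma opGamma_sub_le (v : V3) :
    |weight β v * (opGamma γ b δ ρ f v - opGamma γ b δ ρ g v)|
      ≤ lipConst Cb J W ρ * (12 * (M + M ^ 2) * D) := by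
  have hD0 := (abs_nonneg _).trans (hD 0)
  have hM0 := (abs_nonneg _).trans (hfM 0)
  have hS := gaussConst_one_le A.rho_pos
  have hW := A.one_le_W
  rw [opGamma_eq A hf hfM, opGamma_eq A hg hgM, ← integral_sub (integrable_nonlinDensity A hf hfM v)
    (integrable_nonlinDensity A hg hgM v), ← integral_const_mul]
  have h := abs_integral_kernelB_mul_le (v := v) A.angular A.kernel
    (c := 2 * gaussConst ρ ^ 4 * W * (12 * (M + M ^ 2) * D))
    (d := fun x => weight β v * (1 / sqrtMuBar δ ρ v *
        nonlinDensity δ ρ f v x.1 (postV v x.1 x.2) (postU v x.1 x.2)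
      - 1 / sqrtMuBar δ ρ v * nonlinDensity δ ρ g v x.1 (postV v x.1 x.2) (postU v x.1 x.2)))
    (fun x => (nonlinDensity_sub_le A.beta_nonneg A.delta_nonneg A.delta_le_one A.rho_pos A.one_le_W
      A.weight_gauss (norm_sq_post v x.1 x.2) hD hfM hgM).trans_eq (by ring)) (by positivity)
  refine le_trans (le_of_eq ?_) (h.trans_eq ?_)
  · congr 2
    funext x
    ring
  · unfold lipConst
    ring

/-- The combined Lipschitz bound for `K_δ + Γ_δ` on weighted balls. -/
lemma source_sub_le (v : V3) :
    |weight β v * (opK γ b δ ρ f v + opGamma γ b δ ρ f v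
        - (opK γ b δ ρ g v + opGamma γ b δ ρ g v))|
      ≤ 12 * lipConst Cb J W ρ * (1 + M + M ^ 2) * D := by
  have hD0 := (abs_nonneg _).trans (hD 0)
  have h1 := opK_sub_le A hf hfM hg hgM hD v
  have h2 := opGamma_sub_le A hf hfM hg hgM hD v
  have h3 := mul_nonneg (lipConst_nonneg A) hD0
  have e : weight β v * (opK γ b δ ρ f v + opGamma γ b δ ρ f v
        - (opK γ b δ ρ g v + opGamma γ b δ ρ g v))
      = weight β v * (opK γ b δ ρ f v - opK γ b δ ρ g v)
        + weight β v * (opGamma γ b δ ρ f v - opGamma γ b δ ρ g v) := by ring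
  rw [e]
  refine (abs_add_le _ _).trans ((add_le_add h1 h2).trans ?_)
  nlinarith

end Operators

/-! ### Measurability in parameters, and the spatial domain -/

section Measurability

variable {α : Type*} [MeasurableSpace α] {γ : ℝ} {b : ℝ → ℝ} (hb : Measurable b) (δ ρ : ℝ)
  {f : α → V3 → ℝ} (hf : Measurable (Function.uncurry f)) {v : α → V3} (hv : Measurable v)
include hb hv

lemma measurable_collisionIntegral {d : α → V3 → S2 → ℝ}
    (hd : Measurable fun x : (α × V3) × S2 => d x.1.1 x.1.2 x.2) :
    Measurable fun a => ∫ u : V3, ∫ ω : S2, kernelB γ b (v a) u ω * d a u ω ∂sphereMeasure := by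
  have h : Measurable fun x : (α × V3) × S2 => kernelB γ b (v x.1.1) x.1.2 x.2 * d x.1.1 x.1.2 x.2 :=
    (measurable_kernelB hb (hv.comp (measurable_fst.comp measurable_fst))
      (measurable_snd.comp measurable_fst) measurable_snd).mul hd
  have h1 := h.stronglyMeasurable.integral_prod_right' (ν := sphereMeasure)
  exact (h1.integral_prod_right' (ν := (volume : Measure V3))).measurable

lemma measurable_nu : Measurable fun a => nu γ b δ ρ (v a) := by
  have h1 : Measurable fun x : (α × V3) × S2 => v x.1.1 := by fun_prop
  have h2 : Measurable fun x : (α × V3) × S2 => x.1.2 := by fun_prop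
  have h3 : Measurable fun x : (α × V3) × S2 => x.2 := by fun_prop
  exact measurable_collisionIntegral hb hv (d := fun a u ω =>
    freqDensity δ ρ u (postV (v a) u ω) (postU (v a) u ω))
    (measurable_freqDensity δ ρ h2 (measurable_postV h1 h2 h3) (measurable_postU h1 h2 h3))

include hf

lemma measurable_opK : Measurable fun a => opK γ b δ ρ (f a) (v a) := by
  have h1 : Measurable fun x : (α × V3) × S2 => v x.1.1 := by fun_prop
  have h2 : Measurable fun x : (α × V3) × S2 => x.1.2 := by fun_prop
  have h3 : Measurable fun x : (α × V3) × S2 => x.2 := by fun_prop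
  have h4 : Measurable (Function.uncurry fun x : (α × V3) × S2 => f x.1.1) :=
    hf.comp (g := Function.uncurry f) (f := fun y : ((α × V3) × S2) × V3 => (y.1.1.1, y.2))
      (by fun_prop)
  exact measurable_collisionIntegral hb hv (d := fun a u ω =>
    linDensity δ ρ (f a) (v a) u (postV (v a) u ω) (postU (v a) u ω))
    (measurable_linDensity δ ρ (f := fun x : (α × V3) × S2 => f x.1.1) h4 h1 h2
      (measurable_postV h1 h2 h3) (measurable_postU h1 h2 h3))

lemma measurable_opGamma : Measurable fun a => opGamma γ b δ ρ (f a) (v a) := by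
  have h1 : Measurable fun x : (α × V3) × S2 => v x.1.1 := by fun_prop
  have h2 : Measurable fun x : (α × V3) × S2 => x.1.2 := by fun_prop
  have h3 : Measurable fun x : (α × V3) × S2 => x.2 := by fun_prop
  have h4 : Measurable (Function.uncurry fun x : (α × V3) × S2 => f x.1.1) :=
    hf.comp (g := Function.uncurry f) (f := fun y : ((α × V3) × S2) × V3 => (y.1.1.1, y.2))
      (by fun_prop)
  have h := measurable_collisionIntegral (γ := γ) hb hv (d := fun a u ω =>
    nonlinDensity δ ρ (f a) (v a) u (postV (v a) u ω) (postU (v a) u ω))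
    (measurable_nonlinDensity δ ρ (f := fun x : (α × V3) × S2 => f x.1.1) h4 h1 h2
      (measurable_postV h1 h2 h3) (measurable_postU h1 h2 h3))
  have hr := (measurable_sqrtMuBar δ ρ).comp hv
  exact (measurable_const.div hr).mul h

end Measurability

lemma Domain.measurable_back (Ω : Domain) :
    Measurable fun x : Ω.Point × V3 => Ω.back x.1 x.2 := by
  cases Ω with
  | wholeSpace =>
    exact (measurable_fst.sub measurable_snd : Measurable fun x : V3 × V3 => x.1 - x.2)
  | torus L hL =>
    have h : Measurable fun x : (Fin 3 → AddCircle L) × V3 =>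
        fun i => x.1 i - ((x.2 i : ℝ) : AddCircle L) := by
      refine measurable_pi_lambda _ fun i => ?_
      have h1 : Measurable fun x : (Fin 3 → AddCircle L) × V3 => x.1 i := by fun_prop
      have h2 : Measurable fun x : (Fin 3 → AddCircle L) × V3 => x.2 i := by fun_prop
      exact h1.sub (AddCircle.measurable_mk'.comp h2)
    exact h

lemma Domain.back_zero (Ω : Domain) (x : Ω.Point) : Ω.back x 0 = x := by
  cases Ω with
  | wholeSpace => exact sub_zero (G := V3) x
  | torus L hL =>
    funext i
    simp [Domain.back]

lemma Domain.back_back (Ω : Domain) (x : Ω.Point) (y z : V3) :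
    Ω.back (Ω.back x y) z = Ω.back x (y + z) := by
  cases Ω with
  | wholeSpace => exact sub_sub (α := V3) x y z
  | torus L hL =>
    funext i
    simp [Domain.back, sub_sub]

/-! ### Truncation to the physical range of densities -/

/-- The nearest value `y'` to `y` for which `F = μ(v) + √μ̄(v) y'` satisfies `0 ≤ F` and `δ F ≤ 1`.
For `δ = 0` only the lower constraint is present. -/
noncomputable def clip (δ ρ : ℝ) (v : V3) (y : ℝ) : ℝ :=
  max (-(mu δ ρ v / sqrtMuBar δ ρ v))
    (if δ = 0 then y else min y ((1 - δ * mu δ ρ v) / (δ * sqrtMuBar δ ρ v)))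

lemma measurable_clip {α : Type*} [MeasurableSpace α] (δ ρ : ℝ) {v : α → V3} {y : α → ℝ}
    (hv : Measurable v) (hy : Measurable y) : Measurable fun a => clip δ ρ (v a) (y a) := by
  have hm := (measurable_mu δ ρ).comp hv
  have hr := (measurable_sqrtMuBar δ ρ).comp hv
  simp only [Function.comp_def] at hm hr
  unfold clip
  split_ifs <;> fun_prop

lemma abs_clip_sub_le (δ ρ : ℝ) (v : V3) (y z : ℝ) : |clip δ ρ v y - clip δ ρ v z| ≤ |y - z| := by
  unfold clip
  refine (abs_max_sub_max_le_max _ _ _ _).trans ?_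
  rw [sub_self, abs_zero]
  refine max_le (abs_nonneg _) ?_
  split_ifs
  · exact le_rfl
  · refine (abs_min_sub_min_le_max _ _ _ _).trans ?_
    rw [sub_self, abs_zero]
    exact max_le le_rfl (abs_nonneg _)

section Clip

variable {δ ρ : ℝ} (hδ : 0 ≤ δ) (hρ : 0 < ρ)
include hδ hρ

lemma distribution_lower (v : V3) (y : ℝ) :
    distribution δ ρ v y = sqrtMuBar δ ρ v * (y - -(mu δ ρ v / sqrtMuBar δ ρ v)) := by
  have := sqrtMuBar_pos hδ hρ v
  unfold distribution
  field_simp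
  ring

lemma distribution_upper (hδ0 : δ ≠ 0) (v : V3) (y : ℝ) :
    1 - δ * distribution δ ρ v y
      = δ * sqrtMuBar δ ρ v * ((1 - δ * mu δ ρ v) / (δ * sqrtMuBar δ ρ v) - y) := by
  have := sqrtMuBar_pos hδ hρ v
  unfold distribution
  field_simp
  ring

lemma lower_le_upper (hδ0 : δ ≠ 0) (v : V3) :
    -(mu δ ρ v / sqrtMuBar δ ρ v) ≤ 0 ∧ 0 ≤ (1 - δ * mu δ ρ v) / (δ * sqrtMuBar δ ρ v) := by
  have h1 := sqrtMuBar_pos hδ hρ v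
  have h2 := mu_pos hδ hρ v
  have h3 := sub_pos.2 (delta_mul_mu_lt_one hδ hρ v)
  exact ⟨neg_nonpos.2 (by positivity), by positivity⟩

lemma clip_zero (v : V3) : clip δ ρ v 0 = 0 := by
  have h1 := sqrtMuBar_pos hδ hρ v
  have h2 := mu_pos hδ hρ v
  have h0 : -(mu δ ρ v / sqrtMuBar δ ρ v) ≤ 0 := neg_nonpos.2 (by positivity)
  unfold clip
  split_ifs with h
  · exact max_eq_right h0
  · rw [min_eq_left (lower_le_upper hδ hρ h v).2, max_eq_right h0]

lemma abs_clip_le (v : V3) (y : ℝ) : |clip δ ρ v y| ≤ |y| := by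
  simpa [clip_zero hδ hρ] using abs_clip_sub_le δ ρ v y 0

lemma distribution_clip_mem (v : V3) (y : ℝ) :
    0 ≤ distribution δ ρ v (clip δ ρ v y) ∧ δ * distribution δ ρ v (clip δ ρ v y) ≤ 1 := by
  have hr := sqrtMuBar_pos hδ hρ v
  constructor
  · rw [distribution_lower hδ hρ]
    exact mul_nonneg hr.le (sub_nonneg.2 (le_max_left _ _))
  · by_cases h : δ = 0
    · simp [h]
    · rw [← sub_nonneg, distribution_upper hδ hρ h]
      refine mul_nonneg (by positivity) (sub_nonneg.2 ?_)
      have := lower_le_upper hδ hρ h v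
      rw [clip, if_neg h]
      exact max_le (this.1.trans this.2) (min_le_right _ _)

lemma clip_eq_self {v : V3} {y : ℝ} (h0 : 0 ≤ distribution δ ρ v y)
    (h1 : δ * distribution δ ρ v y ≤ 1) : clip δ ρ v y = y := by
  have hr := sqrtMuBar_pos hδ hρ v
  rw [distribution_lower hδ hρ] at h0
  have h2 := sub_nonneg.1 (nonneg_of_mul_nonneg_right h0 hr)
  unfold clip
  split_ifs with h
  · exact max_eq_right h2
  · rw [← sub_nonneg, distribution_upper hδ hρ h] at h1
    have h3 : 0 < δ * sqrtMuBar δ ρ v := by positivity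
    rw [min_eq_left (sub_nonneg.1 (nonneg_of_mul_nonneg_right h1 h3)), max_eq_right h2]

lemma distribution_clip_of_neg {v : V3} {y : ℝ} (h0 : distribution δ ρ v y < 0) :
    distribution δ ρ v (clip δ ρ v y) = 0 := by
  have hr := sqrtMuBar_pos hδ hρ v
  rw [distribution_lower hδ hρ] at h0 ⊢
  have h2 : y - -(mu δ ρ v / sqrtMuBar δ ρ v) < 0 := by
    by_contra! h
    exact absurd (mul_nonneg hr.le h) (not_le.2 h0)
  have h3 : clip δ ρ v y = -(mu δ ρ v / sqrtMuBar δ ρ v) := by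
    unfold clip
    refine max_eq_left ?_
    split_ifs with h
    · linarith
    · exact (min_le_left _ _).trans (by linarith)
  rw [h3, sub_self, mul_zero]

lemma distribution_clip_of_one_lt {v : V3} {y : ℝ} (h0 : 1 < δ * distribution δ ρ v y) :
    δ * distribution δ ρ v (clip δ ρ v y) = 1 := by
  have hr := sqrtMuBar_pos hδ hρ v
  have h : δ ≠ 0 := by rintro rfl; norm_num at h0
  have h3 : 0 < δ * sqrtMuBar δ ρ v := by positivity
  rw [← sub_neg, distribution_upper hδ hρ h] at h0
  have h2 : (1 - δ * mu δ ρ v) / (δ * sqrtMuBar δ ρ v) - y < 0 := by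
    by_contra! h'
    exact absurd (mul_nonneg h3.le h') (not_le.2 h0)
  have h4 := lower_le_upper hδ hρ h v
  have h5 : clip δ ρ v y = (1 - δ * mu δ ρ v) / (δ * sqrtMuBar δ ρ v) := by
    unfold clip
    rw [if_neg h, min_eq_right (by linarith), max_eq_right (h4.1.trans h4.2)]
  have h6 := distribution_upper hδ hρ h v (clip δ ρ v y)
  rw [h5, sub_self, mul_zero] at h6
  rw [h5]
  linarith

end Clip

/-! ### The Duhamel formula along a trajectory -/

lemma measurable_intervalIntegral {α : Type*} [MeasurableSpace α] {τ : α → ℝ} (hτ : Measurable τ)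
    {F : α → ℝ → ℝ} (hF : Measurable (Function.uncurry F)) :
    Measurable fun a => ∫ s in (0 : ℝ)..τ a, F a s := by
  have key : ∀ l r : α → ℝ, Measurable l → Measurable r →
      Measurable fun a => ∫ s in Ioc (l a) (r a), F a s := by
    intro l r hl hr
    have hset : MeasurableSet {p : α × ℝ | p.2 ∈ Ioc (l p.1) (r p.1)} :=
      (measurableSet_lt (hl.comp measurable_fst) measurable_snd).inter
        (measurableSet_le measurable_snd (hr.comp measurable_fst))
    have h := (hF.indicator hset).stronglyMeasurable.integral_prod_right' (ν := (volume : Measure ℝ))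
    have e : (fun a => ∫ s in Ioc (l a) (r a), F a s) = fun a => ∫ s,
        {p : α × ℝ | p.2 ∈ Ioc (l p.1) (r p.1)}.indicator (Function.uncurry F) (a, s) := by
      funext a
      rw [← integral_indicator measurableSet_Ioc]
      rfl
    rw [e]
    exact h.measurable
  exact (key _ _ measurable_const hτ).sub (key _ _ hτ measurable_const)

lemma intervalIntegrable_of_abs_le {h : ℝ → ℝ} (hm : Measurable h) {t C : ℝ} (ht : 0 ≤ t)
    (hC : ∀ s ∈ Icc 0 t, |h s| ≤ C) : IntervalIntegrable h volume 0 t := by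
  rw [intervalIntegrable_iff_integrableOn_Icc_of_le ht]
  exact Measure.integrableOn_of_bounded (M := C) (by simp) hm.aestronglyMeasurable
    ((ae_restrict_iff' measurableSet_Icc).2 (Filter.Eventually.of_forall hC))

/-- A function that starts nonnegative and does not decrease while negative stays nonnegative. -/
lemma nonneg_of_eq_integral {q g : ℝ → ℝ} {a t : ℝ} (ht : 0 ≤ t) (ha : 0 ≤ a)
    (hg : IntervalIntegrable g volume 0 t) (hq : ∀ s ∈ Icc 0 t, q s = a + ∫ τ in (0 : ℝ)..s, g τ)
    (hneg : ∀ s ∈ Icc 0 t, q s < 0 → 0 ≤ g s) : 0 ≤ q t := by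
  by_contra! hqt
  have hcont : ContinuousOn q (Icc 0 t) := by
    refine ContinuousOn.congr ?_ hq
    have := intervalIntegral.continuousOn_primitive_interval (a := 0) (b := t) (μ := volume)
      (f := g) (by rw [uIcc_of_le ht]
                   exact (intervalIntegrable_iff_integrableOn_Icc_of_le ht).1 hg)
    rw [uIcc_of_le ht] at this
    exact continuousOn_const.add this
  -- the last time at which `q` is nonnegative
  have hclosed : IsClosed (Icc 0 t ∩ q ⁻¹' Ici 0) :=
    hcont.preimage_isClosed_of_isClosed isClosed_Icc isClosed_Ici
  have hcomp : IsCompact (Icc 0 t ∩ q ⁻¹' Ici 0) :=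
    isCompact_Icc.of_isClosed_subset hclosed inter_subset_left
  have h0 : (0 : ℝ) ∈ Icc 0 t ∩ q ⁻¹' Ici 0 := by
    refine ⟨⟨le_rfl, ht⟩, ?_⟩
    rw [mem_preimage, mem_Ici, hq 0 ⟨le_rfl, ht⟩, intervalIntegral.integral_same, add_zero]
    exact ha
  obtain ⟨s₀, ⟨⟨hs0, hst⟩, hqs⟩, hmax⟩ := hcomp.exists_isGreatest ⟨0, h0⟩
  have hgs : IntervalIntegrable g volume 0 s₀ := hg.mono_set (by
    rw [uIcc_of_le hs0, uIcc_of_le ht]; exact Icc_subset_Icc_right hst)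
  have hgst : IntervalIntegrable g volume s₀ t := hg.mono_set (by
    rw [uIcc_of_le hst, uIcc_of_le ht]; exact Icc_subset_Icc_left hs0)
  have hsplit := intervalIntegral.integral_add_adjacent_intervals hgs hgst
  have hpos : 0 ≤ ∫ τ in s₀..t, g τ := by
    rw [intervalIntegral.integral_of_le hst]
    refine setIntegral_nonneg measurableSet_Ioc fun τ hτ => ?_
    have hτI : τ ∈ Icc 0 t := ⟨hs0.trans hτ.1.le, hτ.2⟩
    refine hneg τ hτI ?_
    by_contra! hcon
    exact absurd (hmax ⟨hτI, hcon⟩) (not_le.2 hτ.1)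
  have e1 := hq t ⟨ht, le_rfl⟩
  have e2 := hq s₀ ⟨hs0, hst⟩
  have e3 : 0 ≤ q s₀ := hqs
  linarith

/-- A lower barrier `c` for the equation `y' + ν y = k`, in Duhamel form: it suffices that
`k ≥ ν c` at the times when `y < c`. -/
lemma le_of_duhamel {y k : ℝ → ℝ} {ν y₀ c t : ℝ} (ht : 0 ≤ t) (hc : c ≤ y₀)
    (hk : IntervalIntegrable k volume 0 t)
    (hy : ∀ s ∈ Icc 0 t, y s = Real.exp (-(ν * s)) * y₀
      + ∫ τ in (0 : ℝ)..s, Real.exp (-(ν * (s - τ))) * k τ)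
    (hneg : ∀ s ∈ Icc 0 t, y s < c → ν * c ≤ k s) : c ≤ y t := by
  have hexp : Continuous fun τ : ℝ => Real.exp (ν * τ) := by fun_prop
  have h := nonneg_of_eq_integral (q := fun s => Real.exp (ν * s) * (y s - c))
    (g := fun τ => Real.exp (ν * τ) * (k τ - ν * c)) ht (sub_nonneg.2 hc)
    ((hk.sub intervalIntegrable_const).continuousOn_mul hexp.continuousOn) ?_ ?_
  · exact sub_nonneg.1 (nonneg_of_mul_nonneg_right h (Real.exp_pos _))
  · intro s hs
    have hks : IntervalIntegrable k volume 0 s := hk.mono_set (by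
      rw [uIcc_of_le hs.1, uIcc_of_le ht]; exact Icc_subset_Icc_right hs.2)
    have hftc : ∫ τ in (0 : ℝ)..s, Real.exp (ν * τ) * (ν * c) = Real.exp (ν * s) * c - c := by
      have := intervalIntegral.integral_eq_sub_of_hasDerivAt (a := 0) (b := s)
        (f := fun τ => Real.exp (ν * τ) * c) (f' := fun τ => Real.exp (ν * τ) * (ν * c))
        (fun τ _ => by
          have h1 : HasDerivAt (fun τ : ℝ => ν * τ) ν τ := by
            simpa using (hasDerivAt_id τ).const_mul ν
          have h2 := h1.exp.mul_const c
          rwa [mul_assoc] at h2)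
        (Continuous.intervalIntegrable (by fun_prop) _ _)
      rw [this]
      simp
    have hsub : ∫ τ in (0 : ℝ)..s, Real.exp (ν * τ) * (k τ - ν * c)
        = (∫ τ in (0 : ℝ)..s, Real.exp (ν * τ) * k τ)
          - ∫ τ in (0 : ℝ)..s, Real.exp (ν * τ) * (ν * c) := by
      rw [← intervalIntegral.integral_sub (hks.continuousOn_mul hexp.continuousOn)
        (Continuous.intervalIntegrable (by fun_prop) _ _)]
      simp only [mul_sub]
    have hfac : ∫ τ in (0 : ℝ)..s, Real.exp (-(ν * (s - τ))) * k τ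
        = Real.exp (-(ν * s)) * ∫ τ in (0 : ℝ)..s, Real.exp (ν * τ) * k τ := by
      rw [← intervalIntegral.integral_const_mul]
      congr 1
      funext τ
      rw [← mul_assoc, ← Real.exp_add]
      ring_nf
    rw [hsub, hftc, hy s hs, hfac, ← mul_add, mul_sub, ← mul_assoc, ← Real.exp_add]
    simp only [add_neg_cancel, Real.exp_zero]
    ring
  · intro s hs hlt
    have h1 : y s - c < 0 := by
      by_contra! h'
      exact absurd (mul_nonneg (Real.exp_pos (ν * s)).le h') (not_le.2 hlt)
    exact mul_nonneg (Real.exp_pos _).le (sub_nonneg.2 (hneg s hs (sub_neg.1 h1)))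

/-- The upper barrier, obtained from `le_of_duhamel` by changing signs. -/
lemma duhamel_le {y k : ℝ → ℝ} {ν y₀ c t : ℝ} (ht : 0 ≤ t) (hc : y₀ ≤ c)
    (hk : IntervalIntegrable k volume 0 t)
    (hy : ∀ s ∈ Icc 0 t, y s = Real.exp (-(ν * s)) * y₀
      + ∫ τ in (0 : ℝ)..s, Real.exp (-(ν * (s - τ))) * k τ)
    (hpos : ∀ s ∈ Icc 0 t, c < y s → k s ≤ ν * c) : y t ≤ c := by
  have h := le_of_duhamel (y := fun s => -y s) (k := fun s => -k s) (ν := ν) (y₀ := -y₀) (c := -c)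
    ht (neg_le_neg hc) hk.neg (fun s hs => by
      simp only [mul_neg, intervalIntegral.integral_neg]
      rw [hy s hs]
      ring) (fun s hs hlt => by
      have := hpos s hs (neg_lt_neg_iff.1 hlt)
      linarith)
  exact neg_le_neg_iff.1 h

/-! ### The transport equation with a Lipschitz source -/

/-- `f` solves `∂ₜf + v·∇ₓf + ν f = S(f)`, `f(0) = f₀`, on `[0,T]` in Duhamel form along
trajectories. -/
def SolvesDuhamel (Ω : Domain) (ν : V3 → ℝ) (S : (V3 → ℝ) → V3 → ℝ) (T : ℝ)
    (f₀ : Ω.Point → V3 → ℝ) (f : ℝ → Ω.Point → V3 → ℝ) : Prop :=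
  ∀ t ∈ Icc (0 : ℝ) T, ∀ x v,
    f t x v = Real.exp (-(ν v * t)) * f₀ (Ω.back x (t • v)) v
      + ∫ s in (0 : ℝ)..t, Real.exp (-(ν v * (t - s))) * S (f s (Ω.back x ((t - s) • v))) v

/-- `S` maps measurable families of velocity profiles to measurable families. -/
def MeasurableSource (S : (V3 → ℝ) → V3 → ℝ) : Prop :=
  ∀ (α : Type) [MeasurableSpace α] (f : α → V3 → ℝ) (v : α → V3),
    Measurable (Function.uncurry f) → Measurable v → Measurable fun a => S (f a) (v a)

/-- `S` is Lipschitz with constant `Λ` on the ball of radius `M` of the supremum norm with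
weight `w`. -/
def LipschitzSource (w : V3 → ℝ) (S : (V3 → ℝ) → V3 → ℝ) (M Λ : ℝ) : Prop :=
  ∀ f g : V3 → ℝ, Measurable f → Measurable g → (∀ z, |w z * f z| ≤ M) → (∀ z, |w z * g z| ≤ M) →
    ∀ D, (∀ z, |w z * (f z - g z)| ≤ D) → ∀ v, |w v * (S f v - S g v)| ≤ Λ * D

/-- Joint measurability in `(t, x, v)`. -/
def JointlyMeasurable {Ω : Domain} (f : ℝ → Ω.Point → V3 → ℝ) : Prop :=
  Measurable fun p : ℝ × Ω.Point × V3 => f p.1 p.2.1 p.2.2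

section Transport

variable {Ω : Domain} {ν : V3 → ℝ} {S : (V3 → ℝ) → V3 → ℝ}

lemma JointlyMeasurable.slice {f : ℝ → Ω.Point → V3 → ℝ} (hf : JointlyMeasurable f) (t : ℝ)
    (x : Ω.Point) : Measurable (f t x) :=
  Measurable.comp (g := fun p : ℝ × Ω.Point × V3 => f p.1 p.2.1 p.2.2) hf
    (f := fun v : V3 => (t, x, v)) (by fun_prop)

/-- The integrand of the Duhamel formula is measurable in all its variables. -/
lemma JointlyMeasurable.source (hS : MeasurableSource S) {f : ℝ → Ω.Point → V3 → ℝ}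
    (hf : JointlyMeasurable f) :
    Measurable fun p : (ℝ × Ω.Point × V3) × ℝ =>
      S (f p.2 (Ω.back p.1.2.1 ((p.1.1 - p.2) • p.1.2.2))) p.1.2.2 := by
  refine hS _ (fun p : (ℝ × Ω.Point × V3) × ℝ => f p.2 (Ω.back p.1.2.1 ((p.1.1 - p.2) • p.1.2.2)))
    (fun p => p.1.2.2) ?_ (by fun_prop)
  have hback : Measurable fun y : ((ℝ × Ω.Point × V3) × ℝ) × V3 =>
      Ω.back y.1.1.2.1 ((y.1.1.1 - y.1.2) • y.1.1.2.2) :=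
    Ω.measurable_back.comp (f := fun y : ((ℝ × Ω.Point × V3) × ℝ) × V3 =>
      (y.1.1.2.1, (y.1.1.1 - y.1.2) • y.1.1.2.2)) (by fun_prop)
  exact Measurable.comp (g := fun p : ℝ × Ω.Point × V3 => f p.1 p.2.1 p.2.2) hf
    (f := fun y : ((ℝ × Ω.Point × V3) × ℝ) × V3 =>
      (y.1.2, Ω.back y.1.1.2.1 ((y.1.1.1 - y.1.2) • y.1.1.2.2), y.2)) (by fun_prop)

lemma JointlyMeasurable.source_slice (hS : MeasurableSource S) {f : ℝ → Ω.Point → V3 → ℝ}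
    (hf : JointlyMeasurable f) (t : ℝ) (x : Ω.Point) (v : V3) :
    Measurable fun s : ℝ => S (f s (Ω.back x ((t - s) • v))) v :=
  (hf.source hS).comp (f := fun s : ℝ => ((t, x, v), s)) (by fun_prop)

lemma exp_neg_le_one {a t s : ℝ} (ha : 0 ≤ a) (hs : s ≤ t) : Real.exp (-(a * (t - s))) ≤ 1 := by
  rw [Real.exp_le_one_iff]
  have := mul_nonneg ha (sub_nonneg.2 hs)
  linarith

end Transport

/-- The Picard map of the Duhamel formula, extended by zero to times outside `[0,T]`. -/
noncomputable def duhamelMap (Ω : Domain) (ν : V3 → ℝ) (S : (V3 → ℝ) → V3 → ℝ) (T : ℝ)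
    (f₀ : Ω.Point → V3 → ℝ) (f : ℝ → Ω.Point → V3 → ℝ) (t : ℝ) (x : Ω.Point) (v : V3) : ℝ :=
  (Icc (0 : ℝ) T).indicator (fun t => Real.exp (-(ν v * t)) * f₀ (Ω.back x (t • v)) v
    + ∫ s in (0 : ℝ)..t, Real.exp (-(ν v * (t - s))) * S (f s (Ω.back x ((t - s) • v))) v) t

section Transport

variable {Ω : Domain} {ν : V3 → ℝ} {S : (V3 → ℝ) → V3 → ℝ} {T : ℝ} {f₀ : Ω.Point → V3 → ℝ}
  {w : V3 → ℝ} {M Λ : ℝ}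

lemma jointlyMeasurable_duhamelMap (hν : Measurable ν) (hS : MeasurableSource S)
    (hf₀ : Measurable (Function.uncurry f₀)) {f : ℝ → Ω.Point → V3 → ℝ} (hf : JointlyMeasurable f) :
    JointlyMeasurable (duhamelMap Ω ν S T f₀ f) := by
  have h1 : Measurable fun p : ℝ × Ω.Point × V3 => f₀ (Ω.back p.2.1 (p.1 • p.2.2)) p.2.2 := by
    have hback : Measurable fun p : ℝ × Ω.Point × V3 => Ω.back p.2.1 (p.1 • p.2.2) :=
      Ω.measurable_back.comp (f := fun p : ℝ × Ω.Point × V3 => (p.2.1, p.1 • p.2.2)) (by fun_prop)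
    exact hf₀.comp (f := fun p : ℝ × Ω.Point × V3 => (Ω.back p.2.1 (p.1 • p.2.2), p.2.2))
      (by fun_prop)
  have h2 : Measurable fun p : ℝ × Ω.Point × V3 => ∫ s in (0 : ℝ)..p.1,
      Real.exp (-(ν p.2.2 * (p.1 - s))) * S (f s (Ω.back p.2.1 ((p.1 - s) • p.2.2))) p.2.2 := by
    refine measurable_intervalIntegral (F := fun p : ℝ × Ω.Point × V3 => fun s =>
      Real.exp (-(ν p.2.2 * (p.1 - s))) * S (f s (Ω.back p.2.1 ((p.1 - s) • p.2.2))) p.2.2)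
      measurable_fst (Measurable.mul ?_ (hf.source hS))
    fun_prop
  have h3 : Measurable fun p : ℝ × Ω.Point × V3 => Real.exp (-(ν p.2.2 * p.1)) := by fun_prop
  have hset : MeasurableSet {p : ℝ × Ω.Point × V3 | p.1 ∈ Icc (0 : ℝ) T} :=
    measurable_fst measurableSet_Icc
  exact ((h3.mul h1).add h2).indicator hset

lemma abs_source_le (hw : ∀ v, 0 < w v) (hS0 : ∀ v, S 0 v = 0) (hL : LipschitzSource w S M Λ)
    {f : V3 → ℝ} (hf : Measurable f) (hfM : ∀ z, |w z * f z| ≤ M) (v : V3) :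
    |S f v| ≤ Λ * M / w v := by
  have hM := (abs_nonneg _).trans (hfM 0)
  have h := hL f 0 hf measurable_const hfM (by simpa using hM) M (by simpa using hfM) v
  rw [hS0, sub_zero, abs_mul, abs_of_pos (hw v)] at h
  rwa [le_div_iff₀ (hw v), mul_comm]

lemma intervalIntegrable_duhamel (hν0 : ∀ v, 0 ≤ ν v) (hS : MeasurableSource S)
    (hw : ∀ v, 0 < w v) (hS0 : ∀ v, S 0 v = 0) (hL : LipschitzSource w S M Λ)
    {f : ℝ → Ω.Point → V3 → ℝ} (hf : JointlyMeasurable f)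
    (hfM : ∀ s ∈ Icc 0 T, ∀ y z, |w z * f s y z| ≤ M) {t : ℝ} (ht : t ∈ Icc 0 T)
    (x : Ω.Point) (v : V3) :
    IntervalIntegrable (fun s => S (f s (Ω.back x ((t - s) • v))) v) volume 0 t ∧
    IntervalIntegrable (fun s => Real.exp (-(ν v * (t - s))) * S (f s (Ω.back x ((t - s) • v))) v)
      volume 0 t := by
  have hb : ∀ s ∈ Icc 0 t, |S (f s (Ω.back x ((t - s) • v))) v| ≤ Λ * M / w v := fun s hs =>
    abs_source_le hw hS0 hL (hf.slice _ _) (hfM s ⟨hs.1, hs.2.trans ht.2⟩ _) v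
  have hm := hf.source_slice hS t x v
  refine ⟨intervalIntegrable_of_abs_le hm ht.1 hb, intervalIntegrable_of_abs_le
    (Measurable.mul (by fun_prop) hm) ht.1 (C := Λ * M / w v) fun s hs => ?_⟩
  rw [Pi.mul_apply, abs_mul, abs_of_pos (Real.exp_pos _)]
  exact (mul_le_of_le_one_left (abs_nonneg _) (exp_neg_le_one (hν0 v) hs.2)).trans (hb s hs)

/-- Stability of the Duhamel integral: a bound `D(s)` for the difference of two profiles at time
`s` gets integrated in time. -/
lemma duhamel_integral_sub_le (hν0 : ∀ v, 0 ≤ ν v) (hS : MeasurableSource S)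
    (hw : ∀ v, 0 < w v) (hS0 : ∀ v, S 0 v = 0) (hL : LipschitzSource w S M Λ)
    {f g : ℝ → Ω.Point → V3 → ℝ} (hf : JointlyMeasurable f)
    (hfM : ∀ s ∈ Icc 0 T, ∀ y z, |w z * f s y z| ≤ M) (hg : JointlyMeasurable g)
    (hgM : ∀ s ∈ Icc 0 T, ∀ y z, |w z * g s y z| ≤ M) {D : ℝ → ℝ} (hDc : Continuous D)
    (hD : ∀ s ∈ Icc 0 T, ∀ y z, |w z * (f s y z - g s y z)| ≤ D s) {t : ℝ} (ht : t ∈ Icc 0 T)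
    (x : Ω.Point) (v : V3) :
    |w v * ((∫ s in (0 : ℝ)..t, Real.exp (-(ν v * (t - s))) * S (f s (Ω.back x ((t - s) • v))) v)
      - ∫ s in (0 : ℝ)..t, Real.exp (-(ν v * (t - s))) * S (g s (Ω.back x ((t - s) • v))) v)|
      ≤ ∫ s in (0 : ℝ)..t, Λ * D s := by
  rw [← intervalIntegral.integral_sub (intervalIntegrable_duhamel hν0 hS hw hS0 hL hf hfM ht x v).2
    (intervalIntegrable_duhamel hν0 hS hw hS0 hL hg hgM ht x v).2,
    ← intervalIntegral.integral_const_mul, ← Real.norm_eq_abs]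
  refine intervalIntegral.norm_integral_le_of_norm_le ht.1 (Filter.Eventually.of_forall
    fun s hs => ?_) (Continuous.intervalIntegrable (by fun_prop) _ _)
  have hsT : s ∈ Icc 0 T := ⟨hs.1.le, hs.2.trans ht.2⟩
  have h := hL _ _ (hf.slice s (Ω.back x ((t - s) • v))) (hg.slice s (Ω.back x ((t - s) • v)))
    (hfM s hsT _) (hgM s hsT _) (D s) (hD s hsT _) v
  have e : w v * (Real.exp (-(ν v * (t - s))) * S (f s (Ω.back x ((t - s) • v))) v
      - Real.exp (-(ν v * (t - s))) * S (g s (Ω.back x ((t - s) • v))) v)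
      = Real.exp (-(ν v * (t - s))) * (w v * (S (f s (Ω.back x ((t - s) • v))) v
        - S (g s (Ω.back x ((t - s) • v))) v)) := by ring
  rw [e, Real.norm_eq_abs, abs_mul, abs_of_pos (Real.exp_pos _)]
  exact (mul_le_of_le_one_left (abs_nonneg _) (exp_neg_le_one (hν0 v) hs.2)).trans h

/-- Picard iteration: a solution on `[0,T]` in the ball of twice the size of the data, if `T` is
small against the Lipschitz constant on that ball. -/
theorem exists_solvesDuhamel (hν : Measurable ν) (hν0 : ∀ v, 0 ≤ ν v) (hS : MeasurableSource S)
    (hw : ∀ v, 0 < w v) (hS0 : ∀ v, S 0 v = 0) {N : ℝ} (hN : 0 ≤ N) (hΛ0 : 0 ≤ Λ)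
    (hL : LipschitzSource w S (2 * N) Λ) (hΛ : T * Λ ≤ 1 / 2)
    (hf₀ : Measurable (Function.uncurry f₀)) (hf₀N : ∀ x v, |w v * f₀ x v| ≤ N) :
    ∃ f, JointlyMeasurable f ∧ (∀ t ∈ Icc 0 T, ∀ x v, |w v * f t x v| ≤ 2 * N) ∧
      SolvesDuhamel Ω ν S T f₀ f := by
  set Φ := duhamelMap Ω ν S T f₀ with hΦ
  have hΦ_in : ∀ f, ∀ t ∈ Icc 0 T, ∀ x v, Φ f t x v = Real.exp (-(ν v * t)) * f₀ (Ω.back x (t • v)) v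
      + ∫ s in (0 : ℝ)..t, Real.exp (-(ν v * (t - s))) * S (f s (Ω.back x ((t - s) • v))) v :=
    fun f t ht x v => indicator_of_mem ht _
  have hΦ_out : ∀ f, ∀ t ∉ Icc 0 T, ∀ x v, Φ f t x v = 0 :=
    fun f t ht x v => indicator_of_notMem ht _
  have hΦm : ∀ f, JointlyMeasurable f → JointlyMeasurable (Φ f) := fun f hf =>
    jointlyMeasurable_duhamelMap hν hS hf₀ hf
  -- the integral term contracts by the factor `1/2`
  have hcontr : ∀ f g, JointlyMeasurable f → JointlyMeasurable g →
      (∀ t ∈ Icc 0 T, ∀ x v, |w v * f t x v| ≤ 2 * N) →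
      (∀ t ∈ Icc 0 T, ∀ x v, |w v * g t x v| ≤ 2 * N) → ∀ D,
      (∀ t ∈ Icc 0 T, ∀ x v, |w v * (f t x v - g t x v)| ≤ D) →
      ∀ t ∈ Icc 0 T, ∀ x v, |w v * ((∫ s in (0 : ℝ)..t,
          Real.exp (-(ν v * (t - s))) * S (f s (Ω.back x ((t - s) • v))) v)
        - ∫ s in (0 : ℝ)..t, Real.exp (-(ν v * (t - s))) * S (g s (Ω.back x ((t - s) • v))) v)|
        ≤ 1 / 2 * D := by
    intro f g hf hg hfM hgM D hD t ht x v
    have hD0 := (abs_nonneg _).trans (hD t ht x v)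
    refine (duhamel_integral_sub_le hν0 hS hw hS0 hL hf hfM hg hgM continuous_const hD ht x v).trans ?_
    rw [intervalIntegral.integral_const, smul_eq_mul, sub_zero, ← mul_assoc]
    have : t * Λ ≤ T * Λ := mul_le_mul_of_nonneg_right ht.2 hΛ0
    exact mul_le_mul_of_nonneg_right (this.trans hΛ) hD0
  have hΦc : ∀ f g, JointlyMeasurable f → JointlyMeasurable g →
      (∀ t ∈ Icc 0 T, ∀ x v, |w v * f t x v| ≤ 2 * N) →
      (∀ t ∈ Icc 0 T, ∀ x v, |w v * g t x v| ≤ 2 * N) → ∀ D,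
      (∀ t ∈ Icc 0 T, ∀ x v, |w v * (f t x v - g t x v)| ≤ D) →
      ∀ t ∈ Icc 0 T, ∀ x v, |w v * (Φ f t x v - Φ g t x v)| ≤ 1 / 2 * D := by
    intro f g hf hg hfM hgM D hD t ht x v
    rw [hΦ_in f t ht, hΦ_in g t ht, add_sub_add_left_eq_sub]
    exact hcontr f g hf hg hfM hgM D hD t ht x v
  have h0m : JointlyMeasurable (fun (_ : ℝ) (_ : Ω.Point) (_ : V3) => (0 : ℝ)) := measurable_const
  have h0M : ∀ t ∈ Icc 0 T, ∀ (x : Ω.Point) (v : V3), |w v * (0 : ℝ)| ≤ 2 * N := by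
    intro t _ x v
    simpa using hN
  have hΦM : ∀ f, JointlyMeasurable f → (∀ t ∈ Icc 0 T, ∀ x v, |w v * f t x v| ≤ 2 * N) →
      ∀ t ∈ Icc 0 T, ∀ x v, |w v * Φ f t x v| ≤ 2 * N := by
    intro f hf hfM t ht x v
    have h1 := hcontr f (fun _ _ _ => 0) hf h0m hfM h0M (2 * N) (by simpa using hfM) t ht x v
    have h2 : (∫ s in (0 : ℝ)..t, Real.exp (-(ν v * (t - s))) * S (fun _ => 0) v) = 0 := by
      have : S (fun _ => 0) v = 0 := hS0 v
      simp [this]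
    rw [h2, sub_zero] at h1
    rw [hΦ_in f t ht, mul_add]
    refine (abs_add_le _ _).trans ?_
    have h3 : |w v * (Real.exp (-(ν v * t)) * f₀ (Ω.back x (t • v)) v)| ≤ N := by
      have e : w v * (Real.exp (-(ν v * t)) * f₀ (Ω.back x (t • v)) v)
        = Real.exp (-(ν v * (t - 0))) * (w v * f₀ (Ω.back x (t • v)) v) := by rw [sub_zero]; ring
      rw [e, abs_mul, abs_of_pos (Real.exp_pos _)]
      exact (mul_le_of_le_one_left (abs_nonneg _) (exp_neg_le_one (hν0 v) ht.1)).trans (hf₀N _ _)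
    linarith
  -- the iterates and their limit
  set F : ℕ → ℝ → Ω.Point → V3 → ℝ := fun n => Φ^[n] (fun _ _ _ => 0) with hF
  have hFs : ∀ n, F (n + 1) = Φ (F n) := fun n => Function.iterate_succ_apply' _ _ _
  have hFm : ∀ n, JointlyMeasurable (F n) := by
    intro n
    induction n with
    | zero => exact h0m
    | succ n ih => rw [hFs]; exact hΦm _ ih
  have hFM : ∀ n, ∀ t ∈ Icc 0 T, ∀ x v, |w v * F n t x v| ≤ 2 * N := by
    intro n
    induction n with
    | zero => exact h0M
    | succ n ih => rw [hFs]; exact hΦM _ (hFm n) ih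
  have hFd : ∀ n, ∀ t ∈ Icc 0 T, ∀ x v, |w v * (F n t x v - F (n + 1) t x v)|
      ≤ 2 * N * (1 / 2) ^ n := by
    intro n
    induction n with
    | zero =>
      intro t ht x v
      have := hFM 1 t ht x v
      simpa [hF] using this
    | succ n ih =>
      intro t ht x v
      have := hΦc _ _ (hFm n) (hFm (n + 1)) (hFM n) (hFM (n + 1)) _ ih t ht x v
      rw [hFs n, hFs (n + 1), pow_succ]
      linarith
  have hFdist : ∀ t ∈ Icc 0 T, ∀ x v n, dist (F n t x v) (F (n + 1) t x v)
      ≤ 2 * N / w v * (1 / 2) ^ n := by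
    intro t ht x v n
    have h := hFd n t ht x v
    rw [abs_mul, abs_of_pos (hw v)] at h
    rw [Real.dist_eq, div_mul_eq_mul_div, le_div_iff₀ (hw v)]
    linarith
  have hFout : ∀ n, ∀ t ∉ Icc 0 T, ∀ x v, F n t x v = 0 := by
    intro n t ht x v
    cases n with
    | zero => rfl
    | succ n => rw [hFs]; exact hΦ_out _ t ht x v
  have hlim : ∀ t x v, ∃ l, Filter.Tendsto (fun n => F n t x v) Filter.atTop (nhds l) := by
    intro t x v
    by_cases ht : t ∈ Icc 0 T
    · exact cauchySeq_tendsto_of_complete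
        (cauchySeq_of_le_geometric (1 / 2) (2 * N / w v) (by norm_num) (hFdist t ht x v))
    · exact ⟨0, by simp only [hFout _ t ht x v]; exact tendsto_const_nhds⟩
  choose f hf using hlim
  have hfm : JointlyMeasurable f := by
    refine measurable_of_tendsto_metrizable (f := fun n => fun p : ℝ × Ω.Point × V3 =>
      F n p.1 p.2.1 p.2.2) hFm (tendsto_pi_nhds.2 fun p => hf _ _ _)
  have hfM : ∀ t ∈ Icc 0 T, ∀ x v, |w v * f t x v| ≤ 2 * N := fun t ht x v =>
    le_of_tendsto ((hf t x v).const_mul (w v)).abs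
      (Filter.Eventually.of_forall fun n => hFM n t ht x v)
  have hFf : ∀ n, ∀ t ∈ Icc 0 T, ∀ x v, |w v * (F n t x v - f t x v)| ≤ 4 * N * (1 / 2) ^ n := by
    intro n t ht x v
    have h := dist_le_of_le_geometric_of_tendsto (1 / 2) (2 * N / w v) (by norm_num)
      (hFdist t ht x v) (hf t x v) n
    have e : 2 * N / w v * (1 / 2) ^ n / (1 - 1 / 2) = 4 * N * (1 / 2) ^ n / w v := by ring
    rw [e, Real.dist_eq, le_div_iff₀ (hw v)] at h
    rw [abs_mul, abs_of_pos (hw v)]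
    linarith
  refine ⟨f, hfm, hfM, fun t ht x v => ?_⟩
  rw [← hΦ_in f t ht x v]
  -- `f` and `Φ f` are both limits of the iterates
  refine tendsto_nhds_unique ((hf t x v).comp (Filter.tendsto_add_atTop_nat 1)) ?_
  rw [tendsto_iff_dist_tendsto_zero]
  have hz : Filter.Tendsto (fun n : ℕ => 2 * N / w v * (1 / 2 : ℝ) ^ n) Filter.atTop (nhds 0) := by
    simpa using (tendsto_pow_atTop_nhds_zero_of_lt_one (r := (1 / 2 : ℝ)) (by norm_num)
      (by norm_num)).const_mul (2 * N / w v)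
  refine squeeze_zero (fun n => dist_nonneg) (fun n => ?_) hz
  have h := hΦc _ _ (hFm n) hfm (hFM n) hfM _ (hFf n) t ht x v
  simp only [Function.comp_apply, hFs]
  rw [abs_mul, abs_of_pos (hw v)] at h
  rw [Real.dist_eq, div_mul_eq_mul_div, le_div_iff₀ (hw v)]
  linarith

/-- Uniqueness in a ball of any radius: iterating the stability bound gives
`|f - g| ≤ 2M (Λt)ⁿ / n!` for all `n`. -/
theorem SolvesDuhamel.unique (hν0 : ∀ v, 0 ≤ ν v) (hS : MeasurableSource S)
    (hw : ∀ v, 0 < w v) (hS0 : ∀ v, S 0 v = 0) (hL : LipschitzSource w S M Λ)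
    {f g : ℝ → Ω.Point → V3 → ℝ} (hf : JointlyMeasurable f)
    (hfM : ∀ s ∈ Icc 0 T, ∀ y z, |w z * f s y z| ≤ M) (hg : JointlyMeasurable g)
    (hgM : ∀ s ∈ Icc 0 T, ∀ y z, |w z * g s y z| ≤ M) (hfs : SolvesDuhamel Ω ν S T f₀ f)
    (hgs : SolvesDuhamel Ω ν S T f₀ g) : ∀ t ∈ Icc 0 T, ∀ x v, f t x v = g t x v := by
  have key : ∀ n : ℕ, ∀ t ∈ Icc 0 T, ∀ x v, |w v * (f t x v - g t x v)|
      ≤ 2 * M * ((Λ * t) ^ n / n.factorial) := by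
    intro n
    induction n with
    | zero =>
      intro t ht x v
      rw [mul_sub]
      have := abs_sub (w v * f t x v) (w v * g t x v)
      have h1 := hfM t ht x v
      have h2 := hgM t ht x v
      simp only [pow_zero, Nat.factorial_zero, Nat.cast_one, div_one, mul_one]
      linarith
    | succ n ih =>
      intro t ht x v
      rw [hfs t ht, hgs t ht, add_sub_add_left_eq_sub]
      refine (duhamel_integral_sub_le hν0 hS hw hS0 hL hf hfM hg hgM
        (D := fun s => 2 * M * ((Λ * s) ^ n / n.factorial)) (by fun_prop) ih ht x v).trans_eq ?_
      have e : (fun s : ℝ => Λ * (2 * M * ((Λ * s) ^ n / n.factorial)))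
          = fun s => (2 * M * Λ ^ (n + 1) / n.factorial) * s ^ n := by
        funext s
        rw [mul_pow]
        ring
      rw [e, intervalIntegral.integral_const_mul, integral_pow, Nat.factorial_succ, mul_pow]
      have : (n.factorial : ℝ) ≠ 0 := by positivity
      push_cast
      field_simp
      ring
  intro t ht x v
  have hz : Filter.Tendsto (fun n : ℕ => 2 * M * ((Λ * t) ^ n / n.factorial)) Filter.atTop
      (nhds 0) := by
    simpa using (FloorSemiring.tendsto_pow_div_factorial_atTop (Λ * t)).const_mul (2 * M)
  have h := ge_of_tendsto hz (Filter.Eventually.of_forall fun n => key n t ht x v)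
  have h1 := abs_nonpos_iff.1 h
  rcases mul_eq_zero.1 h1 with h2 | h2
  · exact absurd h2 (hw v).ne'
  · exact sub_eq_zero.1 h2

end Transport

/-! ### Application to the quantum Boltzmann equation -/

/-- The source `K_δ f + Γ_δ(f)` of the equation `∂ₜf + v·∇ₓf + ν_δ f = K_δ f + Γ_δ(f)`. -/
noncomputable def source (γ : ℝ) (b : ℝ → ℝ) (δ ρ : ℝ) (f : V3 → ℝ) (v : V3) : ℝ :=
  opK γ b δ ρ f v + opGamma γ b δ ρ f v

/-- The source evaluated at the truncation of `f` to the physical range. -/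
noncomputable def clippedSource (γ : ℝ) (b : ℝ → ℝ) (δ ρ : ℝ) (f : V3 → ℝ) (v : V3) : ℝ :=
  source γ b δ ρ (fun z => clip δ ρ z (f z)) v

lemma opK_zero (γ : ℝ) (b : ℝ → ℝ) (δ ρ : ℝ) (v : V3) : opK γ b δ ρ 0 v = 0 := by
  simp [opK]

lemma opGamma_zero (γ : ℝ) (b : ℝ → ℝ) (δ ρ : ℝ) (v : V3) : opGamma γ b δ ρ 0 v = 0 := by
  simp [opGamma]

section Sources

variable {γ Cb J β W δ ρ : ℝ} {b : ℝ → ℝ}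

lemma measurableSource_source (hb : Measurable b) : MeasurableSource (source γ b δ ρ) :=
  fun _ _ _ _ hf hv => (measurable_opK hb δ ρ hf hv).add (measurable_opGamma hb δ ρ hf hv)

lemma measurableSource_clippedSource (hb : Measurable b) :
    MeasurableSource (clippedSource γ b δ ρ) := fun _ _ f _ hf hv =>
  measurableSource_source hb _ (fun a z => clip δ ρ z (f a z)) _
    (measurable_clip δ ρ measurable_snd hf) hv

variable (A : Admissible γ Cb J β W δ ρ b) (M : ℝ)
include A

lemma lipschitzSource_source :
    LipschitzSource (weight β) (source γ b δ ρ) M (12 * lipConst Cb J W ρ * (1 + M + M ^ 2)) :=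
  fun _ _ hf hg hfM hgM _ hD v => source_sub_le A hf hfM hg hgM hD v

lemma lipschitzSource_opK : LipschitzSource (weight β) (opK γ b δ ρ) M (lipConst Cb J W ρ * 3) :=
  fun _ _ hf hg hfM hgM _ hD v => (opK_sub_le A hf hfM hg hgM hD v).trans_eq (by ring)

lemma lipschitzSource_opGamma :
    LipschitzSource (weight β) (opGamma γ b δ ρ) M (lipConst Cb J W ρ * (12 * (M + M ^ 2))) :=
  fun _ _ hf hg hfM hgM _ hD v => (opGamma_sub_le A hf hfM hg hgM hD v).trans_eq (by ring)

lemma abs_weight_mul_clip_le {f : V3 → ℝ} {z : V3} (hf : |weight β z * f z| ≤ M) :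
    |weight β z * clip δ ρ z (f z)| ≤ M := by
  rw [abs_mul] at hf ⊢
  exact (mul_le_mul_of_nonneg_left (abs_clip_le A.delta_nonneg A.rho_pos z (f z))
    (abs_nonneg _)).trans hf

lemma lipschitzSource_clippedSource : LipschitzSource (weight β) (clippedSource γ b δ ρ) M
    (12 * lipConst Cb J W ρ * (1 + M + M ^ 2)) := by
  intro f g hf hg hfM hgM D hD v
  refine lipschitzSource_source A M (fun z => clip δ ρ z (f z)) (fun z => clip δ ρ z (g z))
    (measurable_clip δ ρ measurable_id hf) (measurable_clip δ ρ measurable_id hg)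
    (fun z => abs_weight_mul_clip_le A M (hfM z)) (fun z => abs_weight_mul_clip_le A M (hgM z)) D
    (fun z => ?_) v
  have h := hD z
  rw [abs_mul] at h ⊢
  exact (mul_le_mul_of_nonneg_left (abs_clip_sub_le δ ρ z _ _) (abs_nonneg _)).trans h

omit A M in
lemma source_zero (v : V3) : source γ b δ ρ 0 v = 0 := by
  simp [source, opK_zero, opGamma_zero]

lemma clippedSource_zero (v : V3) : clippedSource γ b δ ρ 0 v = 0 := by
  have h : (fun z => clip δ ρ z ((0 : V3 → ℝ) z)) = 0 := by
    funext z
    exact clip_zero A.delta_nonneg A.rho_pos z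
  rw [clippedSource, h, source_zero]

omit M in
lemma weight_pos (v : V3) : 0 < weight β v := zero_lt_one.trans_le (one_le_weight A.beta_nonneg v)

omit M in
/-- The parameters without a weight. -/
lemma Admissible.unweighted : Admissible γ Cb J 0 1 δ ρ b :=
  { A with
    one_le_W := le_rfl
    weight_gauss := fun z => by
      simpa [weight] using gauss_le_one z
    beta_nonneg := le_rfl }

end Sources

lemma weight_zero (v : V3) : weight 0 v = 1 := Real.rpow_zero _

section Solutions

variable {γ Cb J β W δ ρ T M : ℝ} {b : ℝ → ℝ} (A : Admissible γ Cb J β W δ ρ b) {Ω : Domain}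
  {f₀ : Ω.Point → V3 → ℝ} {f : ℝ → Ω.Point → V3 → ℝ}
include A

/-- Solutions of the truncated equation stay in the physical range: along a trajectory, `F` does not
decrease while `F < 0`, since there the truncated density vanishes and only the gain term acts;
likewise `F` does not increase while `δ F > 1`. -/
lemma distribution_mem_of_solvesDuhamel (hfm : JointlyMeasurable f)
    (hfM : ∀ t ∈ Icc 0 T, ∀ x v, |weight β v * f t x v| ≤ M)
    (hf₀ : ∀ x v, 0 ≤ distribution δ ρ v (f₀ x v) ∧ δ * distribution δ ρ v (f₀ x v) ≤ 1)
    (hf : SolvesDuhamel Ω (nu γ b δ ρ) (clippedSource γ b δ ρ) T f₀ f) :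
    ∀ t ∈ Icc 0 T, ∀ x v,
      0 ≤ distribution δ ρ v (f t x v) ∧ δ * distribution δ ρ v (f t x v) ≤ 1 := by
  intro t ht x v
  have hδ := A.delta_nonneg
  have hρ := A.rho_pos
  have hr := sqrtMuBar_pos hδ hρ v
  have hk := (intervalIntegrable_duhamel (nu_nonneg A) (measurableSource_clippedSource A.measurable_b)
    (weight_pos A) (clippedSource_zero A) (lipschitzSource_clippedSource A M) hfm hfM ht x v).1
  -- the equation along the trajectory through `(t, x)`
  have hy : ∀ s ∈ Icc 0 t, f s (Ω.back x ((t - s) • v)) v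
      = Real.exp (-(nu γ b δ ρ v * s)) * f₀ (Ω.back x (t • v)) v
        + ∫ τ in (0 : ℝ)..s, Real.exp (-(nu γ b δ ρ v * (s - τ))) *
            clippedSource γ b δ ρ (f τ (Ω.back x ((t - τ) • v))) v := by
    intro s hs
    rw [hf s ⟨hs.1, hs.2.trans ht.2⟩]
    simp only [Domain.back_back, ← add_smul, sub_add_cancel, sub_add_sub_cancel]
  have hclipm : ∀ s, Measurable fun z => clip δ ρ z (f s (Ω.back x ((t - s) • v)) z) := fun s =>
    measurable_clip δ ρ measurable_id (hfm.slice _ _)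
  have hclipM : ∀ s ∈ Icc 0 t, ∀ z,
      |weight β z * clip δ ρ z (f s (Ω.back x ((t - s) • v)) z)| ≤ M := fun s hs z =>
    abs_weight_mul_clip_le A M (hfM s ⟨hs.1, hs.2.trans ht.2⟩ _ z)
  have hx : Ω.back x ((t - t) • v) = x := by rw [sub_self, zero_smul, Domain.back_zero]
  constructor
  · have hlow : ∀ y, -(mu δ ρ v / sqrtMuBar δ ρ v) ≤ y ↔ 0 ≤ distribution δ ρ v y := fun y => by
      rw [distribution_lower hδ hρ, mul_nonneg_iff_of_pos_left hr, sub_nonneg]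
    have h := le_of_duhamel (c := -(mu δ ρ v / sqrtMuBar δ ρ v)) ht.1
      ((hlow _).2 (hf₀ _ _).1) hk hy (fun s hs hlt => by
        have h0 := distribution_clip_of_neg hδ hρ (not_le.1 (mt (hlow _).2 (not_le.2 hlt)))
        have h1 := source_ge_of_distribution_eq_zero A (hclipm s) (hclipM s hs)
          (fun z => distribution_clip_mem hδ hρ z _) h0
        have h2 : clip δ ρ v (f s (Ω.back x ((t - s) • v)) v) = -(mu δ ρ v / sqrtMuBar δ ρ v) := by
          rw [distribution_lower hδ hρ] at h0
          exact sub_eq_zero.1 ((mul_eq_zero.1 h0).resolve_left hr.ne')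
        simp only [h2] at h1
        exact h1)
    rw [hx] at h
    exact (hlow _).1 h
  · by_cases hδ0 : δ = 0
    · simp [hδ0]
    have hδr : 0 < δ * sqrtMuBar δ ρ v := by positivity
    have hup : ∀ y, y ≤ (1 - δ * mu δ ρ v) / (δ * sqrtMuBar δ ρ v)
        ↔ δ * distribution δ ρ v y ≤ 1 := fun y => by
      rw [← sub_nonneg (a := (1 : ℝ)), distribution_upper hδ hρ hδ0, mul_nonneg_iff_of_pos_left hδr,
        sub_nonneg]
    have h := duhamel_le (c := (1 - δ * mu δ ρ v) / (δ * sqrtMuBar δ ρ v)) ht.1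
      ((hup _).2 (hf₀ _ _).2) hk hy (fun s hs hlt => by
        have h0 := distribution_clip_of_one_lt hδ hρ (not_le.1 (mt (hup _).2 (not_le.2 hlt)))
        have h1 := source_le_of_distribution_eq_one A (hclipm s) (hclipM s hs)
          (fun z => distribution_clip_mem hδ hρ z _) h0
        have h2 : clip δ ρ v (f s (Ω.back x ((t - s) • v)) v)
            = (1 - δ * mu δ ρ v) / (δ * sqrtMuBar δ ρ v) := by
          rw [← sub_eq_zero, ← neg_eq_zero, neg_sub, distribution_upper hδ hρ hδ0] at h0
          exact (sub_eq_zero.1 ((mul_eq_zero.1 h0).resolve_left hδr.ne')).symm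
        simp only [h2] at h1
        exact h1)
    rw [hx] at h
    exact (hup _).1 h

/-- Within the physical range the truncation is inactive. -/
lemma SolvesDuhamel.of_clipped
    (hF : ∀ t ∈ Icc 0 T, ∀ x v,
      0 ≤ distribution δ ρ v (f t x v) ∧ δ * distribution δ ρ v (f t x v) ≤ 1)
    (hf : SolvesDuhamel Ω (nu γ b δ ρ) (clippedSource γ b δ ρ) T f₀ f) :
    SolvesDuhamel Ω (nu γ b δ ρ) (source γ b δ ρ) T f₀ f := by
  intro t ht x v
  rw [hf t ht x v]
  congr 1
  refine intervalIntegral.integral_congr fun s hs => ?_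
  rw [uIcc_of_le ht.1] at hs
  have e : (fun z => clip δ ρ z (f s (Ω.back x ((t - s) • v)) z)) = f s (Ω.back x ((t - s) • v)) := by
    funext z
    have h := hF s ⟨hs.1, hs.2.trans ht.2⟩ (Ω.back x ((t - s) • v)) z
    exact clip_eq_self A.delta_nonneg A.rho_pos h.1 h.2
  simp only [clippedSource, e]

/-- For bounded functions the two integrals in the mild formulation can be merged. -/
lemma duhamel_source_eq (hfm : JointlyMeasurable f) (hfM : ∀ t ∈ Icc 0 T, ∀ x v, |f t x v| ≤ M)
    {t : ℝ} (ht : t ∈ Icc 0 T) (x : Ω.Point) (v : V3) :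
    ∫ s in (0 : ℝ)..t, Real.exp (-(nu γ b δ ρ v * (t - s))) *
        source γ b δ ρ (f s (Ω.back x ((t - s) • v))) v
      = (∫ s in (0 : ℝ)..t, Real.exp (-(nu γ b δ ρ v * (t - s))) *
          opK γ b δ ρ (f s (Ω.back x ((t - s) • v))) v)
      + ∫ s in (0 : ℝ)..t, Real.exp (-(nu γ b δ ρ v * (t - s))) *
          opGamma γ b δ ρ (f s (Ω.back x ((t - s) • v))) v := by
  have A0 := A.unweighted
  have hfM' : ∀ t ∈ Icc 0 T, ∀ x v, |weight 0 v * f t x v| ≤ M := by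
    simpa only [weight_zero, one_mul] using hfM
  rw [← intervalIntegral.integral_add
    (intervalIntegrable_duhamel (nu_nonneg A)
      (fun _ _ _ _ hf hv => measurable_opK A.measurable_b δ ρ hf hv)
      (weight_pos A0) (opK_zero γ b δ ρ) (lipschitzSource_opK A0 M) hfm hfM' ht x v).2
    (intervalIntegrable_duhamel (nu_nonneg A)
      (fun _ _ _ _ hf hv => measurable_opGamma A.measurable_b δ ρ hf hv)
      (weight_pos A0) (opGamma_zero γ b δ ρ) (lipschitzSource_opGamma A0 M) hfm hfM' ht x v).2]
  simp only [source, mul_add]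

lemma isMildSolution_of_solvesDuhamel (hfm : JointlyMeasurable f)
    (hfM : ∀ t ∈ Icc 0 T, ∀ x v, |f t x v| ≤ M)
    (hf : SolvesDuhamel Ω (nu γ b δ ρ) (source γ b δ ρ) T f₀ f) :
    IsMildSolution Ω γ b δ ρ T f₀ f where
  measurable := Measurable.comp (g := fun p : ℝ × Ω.Point × V3 => f p.1 p.2.1 p.2.2) hfm
    (f := fun p : Icc (0 : ℝ) T × Ω.Point × V3 => ((p.1 : ℝ), p.2)) (by fun_prop)
  bounded := ⟨M, hfM⟩
  mild := fun t ht x v => by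
    rw [hf t ht x v, duhamel_source_eq A hfm hfM ht x v, add_assoc]

/-- A mild solution agrees on `[0,T]` with a bounded measurable solution defined for all times,
obtained by freezing it outside `[0,T]`. -/
lemma IsMildSolution.exists_extension (hT : 0 ≤ T) (hf : IsMildSolution Ω γ b δ ρ T f₀ f) :
    ∃ f' M', JointlyMeasurable f' ∧ (∀ t ∈ Icc 0 T, ∀ x v, |f' t x v| ≤ M') ∧
      SolvesDuhamel Ω (nu γ b δ ρ) (source γ b δ ρ) T f₀ f' ∧
      ∀ t ∈ Icc 0 T, f' t = f t := by
  obtain ⟨M', hM'⟩ := hf.bounded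
  have e : ∀ t ∈ Icc 0 T, f (projIcc 0 T hT t) = f t := fun t ht => by
    rw [projIcc_of_mem hT ht]
  have hm : JointlyMeasurable fun t => f (projIcc 0 T hT t) :=
    hf.measurable.comp (f := fun p : ℝ × Ω.Point × V3 => (projIcc 0 T hT p.1, p.2))
      ((continuous_projIcc.measurable.comp measurable_fst).prodMk measurable_snd)
  have hb : ∀ t ∈ Icc 0 T, ∀ x v, |f (projIcc 0 T hT t) x v| ≤ M' := fun t ht x v => by
    rw [e t ht]; exact hM' t ht x v
  refine ⟨fun t => f (projIcc 0 T hT t), M', hm, hb, fun t ht x v => ?_, e⟩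
  rw [duhamel_source_eq A hm hb ht x v]
  simp only
  rw [e t ht, hf.mild t ht x v, add_assoc]
  congr 2
  · refine intervalIntegral.integral_congr fun s hs => ?_
    rw [uIcc_of_le ht.1] at hs
    simp only [e s ⟨hs.1, hs.2.trans ht.2⟩]
  · refine intervalIntegral.integral_congr fun s hs => ?_
    rw [uIcc_of_le ht.1] at hs
    simp only [e s ⟨hs.1, hs.2.trans ht.2⟩]

/-- Uniqueness of mild solutions among all bounded functions, without a weight. -/
lemma IsMildSolution.unique (hT : 0 ≤ T) {g : ℝ → Ω.Point → V3 → ℝ}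
    (hf : IsMildSolution Ω γ b δ ρ T f₀ f) (hg : IsMildSolution Ω γ b δ ρ T f₀ g) :
    ∀ t ∈ Icc 0 T, ∀ x v, g t x v = f t x v := by
  obtain ⟨f', M₁, hfm, hfM, hfs, hfe⟩ := hf.exists_extension A hT
  obtain ⟨g', M₂, hgm, hgM, hgs, hge⟩ := hg.exists_extension A hT
  have A0 := A.unweighted
  intro t ht x v
  rw [← hfe t ht, ← hge t ht]
  refine SolvesDuhamel.unique (M := max M₁ M₂) (nu_nonneg A) (measurableSource_source A.measurable_b)
    (weight_pos A0) source_zero (lipschitzSource_source A0 _) hgm ?_ hfm ?_ hgs hfs t ht x v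
  · intro s hs y z
    rw [weight_zero, one_mul]
    exact (hgM s hs y z).trans (le_max_right _ _)
  · intro s hs y z
    rw [weight_zero, one_mul]
    exact (hfM s hs y z).trans (le_max_left _ _)

end Solutions

lemma abs_le_toReal_weightedNorm {Ω : Domain} {β : ℝ} {g : Ω.Point → V3 → ℝ}
    (h : weightedNorm Ω β g < ⊤) (x : Ω.Point) (v : V3) :
    |weight β v * g x v| ≤ (weightedNorm Ω β g).toReal := by
  rw [← ENNReal.ofReal_le_iff_le_toReal h.ne]
  exact le_iSup₂ (f := fun (v : V3) (x : Ω.Point) => ENNReal.ofReal |weight β v * g x v|) v x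

lemma weightedNormT_le {Ω : Domain} {β T C : ℝ} {f : ℝ → Ω.Point → V3 → ℝ}
    (h : ∀ t ∈ Icc 0 T, ∀ x v, |weight β v * f t x v| ≤ C) :
    weightedNormT Ω β T f ≤ ENNReal.ofReal C :=
  iSup₂_le fun t ht => iSup₂_le fun v x => ENNReal.ofReal_le_ofReal (h t ht x v)

end QuantumBoltzmann

theorem theorem1p1 :
    ∃ Cstar : ℝ → ℝ, ContinuousOn Cstar (Set.Ioi 0) ∧ (∀ ρ : ℝ, 0 < ρ → 0 < Cstar ρ) ∧
      ∀ γ β Cb : ℝ, -3 < γ → γ < 0 → 6 < β →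
      ∃ C₁ : ℝ, 0 < C₁ ∧
        ∀ (b : ℝ → ℝ), Measurable b →
          (∀ θ ∈ Set.Icc (0 : ℝ) Real.pi, 0 ≤ b θ ∧ b θ ≤ Cb * |Real.cos θ|) →
        ∀ (Ω : QuantumBoltzmann.Domain) (δ ρ : ℝ), 0 ≤ δ → δ ≤ 1 → 0 < ρ →
        ∀ f₀ : Ω.Point → QuantumBoltzmann.V3 → ℝ, Measurable (Function.uncurry f₀) →
          -- `0 ≤ F₀ ≤ 1/δ` (no upper bound if `δ = 0`)
          (∀ x v, 0 ≤ QuantumBoltzmann.distribution δ ρ v (f₀ x v) ∧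
            δ * QuantumBoltzmann.distribution δ ρ v (f₀ x v) ≤ 1) →
          QuantumBoltzmann.weightedNorm Ω β f₀ < ⊤ →
        ∀ N T₁ : ℝ, N = (QuantumBoltzmann.weightedNorm Ω β f₀).toReal →
          T₁ = C₁ / (Cstar ρ * (1 + N + N ^ 2)) →
        ∃ f : ℝ → Ω.Point → QuantumBoltzmann.V3 → ℝ,
          QuantumBoltzmann.IsMildSolution Ω γ b δ ρ T₁ f₀ f ∧
          (∀ t ∈ Set.Icc (0 : ℝ) T₁, ∀ x v,
            0 ≤ QuantumBoltzmann.distribution δ ρ v (f t x v) ∧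
              δ * QuantumBoltzmann.distribution δ ρ v (f t x v) ≤ 1) ∧
          QuantumBoltzmann.weightedNormT Ω β T₁ f ≤ 2 * QuantumBoltzmann.weightedNorm Ω β f₀ ∧
          -- uniqueness
          ∀ g : ℝ → Ω.Point → QuantumBoltzmann.V3 → ℝ,
            QuantumBoltzmann.IsMildSolution Ω γ b δ ρ T₁ f₀ g →
            ∀ t ∈ Set.Icc (0 : ℝ) T₁, ∀ x v, g t x v = f t x v := by
  open QuantumBoltzmann in
  refine ⟨fun ρ => gaussConst ρ ^ 4, ?_, fun ρ hρ => ?_, ?_⟩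
  · unfold gaussConst
    refine ContinuousOn.pow (ContinuousOn.add (by fun_prop) ?_) 4
    exact continuousOn_const.div continuousOn_id fun ρ hρ => (Set.mem_Ioi.1 hρ).ne'
  · have := gaussConst_one_le hρ
    positivity
  intro γ β Cb hγ hγ0 hβ
  obtain ⟨J, hJ⟩ := exists_kernelBound hγ hγ0
  obtain ⟨W, hW1, hW⟩ := exists_weight_mul_gauss_le β
  have hJ0 := hJ.1
  have hP : 0 ≤ W * |Cb| * J := by positivity
  refine ⟨1 / (192 * (W * |Cb| * J + 1)), by positivity, ?_⟩
  intro b hb hbd Ω δ ρ hδ hδ1 hρ f₀ hf₀ hF₀ hfin N T₁ hN hT₁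
  have A : Admissible γ Cb J β W δ ρ b :=
    ⟨hb, hbd, hJ, hW1, hW, by linarith, hδ, hδ1, hρ⟩
  have hS := gaussConst_one_le hρ
  have hN0 : 0 ≤ N := hN ▸ ENNReal.toReal_nonneg
  have hT0 : 0 ≤ T₁ := by rw [hT₁]; positivity
  have hΛ0 : 0 ≤ 12 * lipConst Cb J W ρ * (1 + 2 * N + (2 * N) ^ 2) := by
    have := lipConst_nonneg A
    positivity
  -- `1 + 2N + (2N)² ≤ 4 (1 + N + N²)` explains the factor `192 = 2 · 4 · 12 · 2` in `C₁`
  have hΛ : T₁ * (12 * lipConst Cb J W ρ * (1 + 2 * N + (2 * N) ^ 2)) ≤ 1 / 2 := by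
    calc T₁ * (12 * lipConst Cb J W ρ * (1 + 2 * N + (2 * N) ^ 2))
        ≤ T₁ * (12 * lipConst Cb J W ρ * (4 * (1 + N + N ^ 2))) := by
          have := lipConst_nonneg A
          gcongr
          nlinarith
      _ = 1 / 2 * ((W * |Cb| * J) / (W * |Cb| * J + 1)) := by
          rw [hT₁]
          unfold lipConst
          have h1 : gaussConst ρ ≠ 0 := by positivity
          have h2 : 1 + N + N ^ 2 ≠ 0 := by positivity
          field_simp
          ring
      _ ≤ 1 / 2 * 1 := by
          gcongr
          rw [div_le_one (by positivity)]
          linarith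
      _ = 1 / 2 := mul_one _
  have hf₀N : ∀ x v, |weight β v * f₀ x v| ≤ N := fun x v =>
    hN ▸ abs_le_toReal_weightedNorm hfin x v
  have hν : Measurable (nu γ b δ ρ) := measurable_nu hb δ ρ measurable_id
  obtain ⟨f, hfm, hfM, hf⟩ := exists_solvesDuhamel hν (nu_nonneg A)
    (measurableSource_clippedSource hb) (weight_pos A) (clippedSource_zero A) hN0 hΛ0
    (lipschitzSource_clippedSource A (2 * N)) hΛ hf₀ hf₀N
  have hF := distribution_mem_of_solvesDuhamel A hfm hfM hF₀ hf
  have hfM1 : ∀ t ∈ Set.Icc 0 T₁, ∀ x v, |f t x v| ≤ 2 * N := fun t ht x v => by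
    refine le_trans ?_ (hfM t ht x v)
    rw [abs_mul, abs_of_pos (weight_pos A v)]
    exact le_mul_of_one_le_left (abs_nonneg _) (one_le_weight A.beta_nonneg v)
  have hmild := isMildSolution_of_solvesDuhamel A hfm hfM1 (hf.of_clipped A hF)
  refine ⟨f, hmild, hF, ?_, fun g hg => hmild.unique A hT0 hg⟩
  refine (weightedNormT_le hfM).trans_eq ?_
  rw [ENNReal.ofReal_mul (by norm_num), hN, ENNReal.ofReal_toReal hfin.ne]
  norm_num
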